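/- Let $D$ be an oriented virtual link diagram, considered through its Gauss diagram. Fix the following conventions. A quandle is a set $X$ with an operation $*$ such that $x*x=x$, each map $x\mapsto x*y$ is a bijection, and $(x*y)*z=(x*z)*(y*z)$. The fundamental quandle $Q(D)$ is generated by the arcs of $D$ (running from one under-crossing to the next), with one relation $a*b=c$ for each classical crossing, where $b$ is the over-crossing arc and $a$, respectively $c$, is the under-crossing arc to the right, respectively to the left, of $b$. For a finite quandle $X$ let $\mathrm{Col}_X(D)=\mathrm{Hom}(Q(D),X)$ be the set of colorings. For an abelian group $A$ (written multiplicatively), a $2$-cocycle is a map $\phi:X\times X\to A$ with $\phi(x,z)\,\phi(x*z,y*z)=\phi(x*y,z)\,\phi(x,y)$ and $\phi(x,x)=1$ for all $x,y,z\in X$. Its cocycle counting invariant is $$\Phi_X^\phi(D)=\sum_{\chi\in\mathrm{Col}_X(D)}\ \prod_{\tau}\phi(\chi(a_\tau),\chi(b_\tau))^{\operatorname{sign}(\tau)}\in\mathbb{Z}[A],$$ where $\tau$ runs through the classical crossings of $D$, with $a_\tau,b_\tau$ as above. The diagram $\mathrm{Zh}(D)$ is obtained from $D$ by adding one new component $\omega$.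 Next to each classical crossing $\tau$ of $D$, $\omega$ passes over two short arcs of $D$: either the two on the right of $\tau$, or the two on the left (when both strands of $\tau$ point upwards), one belonging to the under-strand and one to the over-strand of $\tau$; the new crossing on the under-strand has the sign of $\tau$, the one on the over-strand has the opposite sign. These over-passages are joined in an arbitrary order to a single closed curve, and all other intersections of $\omega$ with $D$ and with itself are virtual. Put $\widetilde{\mathrm{Col}}_X(D)=\mathrm{Col}_X(\mathrm{Zh}(D))$ and $\widetilde\Phi{}^{\phi}_X(D)=\Phi^{\phi}_X(\mathrm{Zh}(D))$. The diagram $D$ is Alexander numerable if its short arcs (running from one classical crossing to the next) can be labeled by integers so that at every classical crossing, drawn with both strands pointing upwards, the two short arcs on the left have the same label $i+1$ and the two on the right have the same label $i$, for some integer $i$ depending on the crossing. It is almost classical if it is equivalent, under Reidemeister and detour moves, to an Alexander numerable diagram. **Statement.** Let $X$ be a finite quandle and $D$ a virtual link diagram. If $D$ is almost classical, then, for every way of drawing $\mathrm{Zh}(D)$, $$|\widetilde{\mathrm{Col}}_X(D)|=|X|\cdot|\mathrm{Col}_X(D)|,$$ and for every abelian group $A$ and every $2$-cocycle $\phi:X\times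 X\to A$, $$\widetilde\Phi{}^{\phi}_X(D)=|X|\cdot\Phi^{\phi}_X(D)\in\mathbb{Z}[A].$$ In particular, if $D$ is equivalent to the unknot, then $|\widetilde{\mathrm{Col}}_X(D)|=|X|^2$ and $\widetilde\Phi{}^{\phi}_X(D)=|X|^2\cdot 1\in\mathbb{Z}[A]$. -/

import Mathlib

open scoped Quandles

universe u v

/-! ### Gauss diagrams and virtual links -/

/-- The two strands at a classical crossing. In a Gauss diagram an arrow points from its `over`
endpoint to its `under` endpoint. -/
inductive Strand
  | over
  | under
  deriving DecidableEq

instance : Fintype Strand where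
  elems := {.over, .under}
  complete := by
    intro x
    cases x <;> simp

/-- A (finite, oriented) virtual link diagram of `n` components, recorded by its Gauss diagram:
a finite set of classical crossings (arrows) with signs, and, for each of the `n` oriented circles,
the cyclic word of the arrow endpoints met when one travels around it (starting from an arbitrary
base point). A circle without classical crossings has the empty word. Virtual crossings leave no
trace in the Gauss diagram, so planar isotopies and detour moves act trivially. -/
structure GaussDiagram (n : ℕ) where
  /-- the classical crossings -/
  Crossing : Type
  [fintypeCrossing : Fintype Crossing]
  [decEqCrossing : DecidableEq Crossing]
  /-- the crossing signs -/
  sign : Crossing → ℤˣ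
  /-- the Gauss word of each component -/
  word : Fin n → List (Crossing × Strand)
  /-- the component that contains a given endpoint -/
  comp : Crossing × Strand → Fin n
  mem_word : ∀ e i, e ∈ word i ↔ comp e = i
  nodup : ∀ i, (word i).Nodup

attribute [instance] GaussDiagram.fintypeCrossing GaussDiagram.decEqCrossing

namespace GaussDiagram

variable {n : ℕ}

/-- The arrow endpoints of a diagram: passages through its classical crossings. -/
abbrev Endpoint (D : GaussDiagram n) : Type := D.Crossing × Strand

theorem mem_comp (D : GaussDiagram n) (e : D.Endpoint) : e ∈ D.word (D.comp e) :=
  (D.mem_word e _).2 rfl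

/-- The endpoint that precedes `e` on its oriented circle. -/
def pred (D : GaussDiagram n) (e : D.Endpoint) : D.Endpoint :=
  (D.word (D.comp e)).prev e (D.mem_comp e)

/-- `D.Consecutive x y`: the two-letter subword `x y` occurs, cyclically, on some circle. -/
def Consecutive (D : GaussDiagram n) (x y : D.Endpoint) : Prop :=
  ∃ i l, D.word i ~r x :: y :: l

/-! ### Equivalence of virtual link diagrams -/

/-- `D` and `D'` are the same Gauss diagram, up to the names of the crossings, the base points on
the circles and the numbering of the components. -/
def Iso (D D' : GaussDiagram n) : Prop :=
  ∃ (g : D.Crossing ≃ D'.Crossing) (σ : Equiv.Perm (Fin n)),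
    (∀ c, D'.sign (g c) = D.sign c) ∧
    ∀ i, D'.word (σ i) ~r (D.word i).map (Prod.map g id)

/-- `D'` is what remains of `D` when the arrows in `S` are erased. -/
def IsErasure (D D' : GaussDiagram n) (S : Finset D.Crossing) : Prop :=
  ∃ g : D'.Crossing → D.Crossing, Function.Injective g ∧
    (∀ c, c ∈ Set.range g ↔ c ∉ S) ∧
    (∀ c, D.sign (g c) = D'.sign c) ∧
    ∀ i, (D'.word i).map (Prod.map g id) = (D.word i).filter (fun e => e.1 ∉ S)

/-- First Reidemeister move (in the direction that removes a crossing): an arrow, of any sign and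
direction, whose two endpoints are consecutive on a circle is erased. -/
def Omega1 (D D' : GaussDiagram n) : Prop :=
  ∃ c : D.Crossing,
    (D.Consecutive (c, .over) (c, .under) ∨ D.Consecutive (c, .under) (c, .over)) ∧
    D.IsErasure D' {c}

/-- Second Reidemeister move (in the direction that removes two crossings): two arrows of opposite
signs, with consecutive tails and with consecutive heads (in either order: the two strands may be
parallel or antiparallel), are erased. -/
def Omega2 (D D' : GaussDiagram n) : Prop :=
  ∃ c d : D.Crossing, D.sign c = -D.sign d ∧
    D.Consecutive (c, .over) (d, .over) ∧
    (D.Consecutive (c, .under) (d, .under) ∨ D.Consecutive (d, .under) (c, .under)) ∧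
    D.IsErasure D' {c, d}

/-- `x` comes immediately before `y` if `t = 1`, immediately after `y` if `t = -1`. -/
def Ordered (D : GaussDiagram n) (t : ℤˣ) (x y : D.Endpoint) : Prop :=
  if t = 1 then D.Consecutive x y else D.Consecutive y x

/-- Third Reidemeister move. Three strands, top, middle and bottom, cross pairwise: `a` is the
crossing of top over middle, `b` of top over bottom, `c` of middle over bottom. The orders in which
the strands meet these crossings depend on the three crossing signs and on a sign `s` that tells on
which side of the bottom strand the crossing `a` lies. For each of the three strands, the move
transposes its two (consecutive) passages. All orientations of the strands are covered. -/
def Omega3 (D D' : GaussDiagram n) : Prop :=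
  ∃ (a b c : D.Crossing) (s : ℤˣ), a ≠ b ∧ a ≠ c ∧ b ≠ c ∧
    D.Ordered (-s * D.sign b) (b, .over) (a, .over) ∧
    D.Ordered (-s * D.sign c) (c, .over) (a, .under) ∧
    D.Ordered (s * D.sign a * D.sign b * D.sign c) (b, .under) (c, .under) ∧
    ∃ g : D.Crossing ≃ D'.Crossing, (∀ x, D'.sign (g x) = D.sign x) ∧
      ∀ i, D'.word i = (D.word i).map (fun e => Prod.map g id
        ((Equiv.swap ((b, .over) : D.Endpoint) (a, .over) *
          Equiv.swap ((c, .over) : D.Endpoint) (a, .under) *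
          Equiv.swap ((b, .under) : D.Endpoint) (c, .under)) e))

/-- One elementary move. -/
def Move (D D' : GaussDiagram n) : Prop :=
  D.Iso D' ∨ D.Omega1 D' ∨ D.Omega2 D' ∨ D.Omega3 D'

/-- Equivalence of virtual link diagrams: the equivalence relation generated by the moves. -/
def VirtualEquiv : GaussDiagram n → GaussDiagram n → Prop :=
  Relation.EqvGen Move

/-- The one-component diagram without classical crossings. -/
def unknot : GaussDiagram 1 where
  Crossing := Empty
  sign := Empty.elim
  word := fun _ => []
  comp := fun e => e.1.elim
  mem_word := fun e => e.1.elim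
  nodup := fun _ => List.nodup_nil

/-! ### Arcs, Alexander numberings, almost classical links -/

/-- Short arcs run from one classical crossing passage to the next: `Sum.inl e` is the short arc
that starts at the endpoint `e`. A circle without classical crossings is itself a short arc. -/
abbrev ShortArc (D : GaussDiagram n) : Type :=
  D.Endpoint ⊕ {i : Fin n // D.word i = []}

/-- The short arc that leaves the endpoint `e`. -/
def outgoing (D : GaussDiagram n) (e : D.Endpoint) : D.ShortArc := Sum.inl e

/-- The short arc that arrives at the endpoint `e`. -/
def incoming (D : GaussDiagram n) (e : D.Endpoint) : D.ShortArc := Sum.inl (D.pred e)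

/-- An Alexander numbering of the short arcs. When a crossing is drawn with both strands pointing
upwards, the incoming and the outgoing short arc on the left carry the same number, those on the
right carry the same number, and the left number is the right number plus one. At a positive
crossing the strand from right to left is the under-strand, at a negative one the over-strand. -/
def IsAlexanderNumbering (D : GaussDiagram n) (f : D.ShortArc → ℤ) : Prop :=
  ∀ c : D.Crossing,
    f (D.incoming (c, .over)) = f (D.outgoing (c, .under)) ∧
    f (D.incoming (c, .under)) = f (D.outgoing (c, .over)) ∧
    f (D.outgoing (c, .under)) = f (D.incoming (c, .under)) + (D.sign c : ℤ)

/-- `D` has an Alexander numbering. -/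
def AlexanderNumerable (D : GaussDiagram n) : Prop :=
  ∃ f : D.ShortArc → ℤ, D.IsAlexanderNumbering f

/-- `D` represents an almost classical link: some equivalent diagram is Alexander numerable. -/
def AlmostClassical (D : GaussDiagram n) : Prop :=
  ∃ D' : GaussDiagram n, D.VirtualEquiv D' ∧ D'.AlexanderNumerable

/-- Two short arcs that meet at an over-passage. -/
inductive ArcStep (D : GaussDiagram n) : D.ShortArc → D.ShortArc → Prop
  | over (c : D.Crossing) : ArcStep D (D.incoming (c, .over)) (D.outgoing (c, .over))

/-- The arcs, which run from one under-passage to the next: short arcs are joined at over-passages.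
A circle without under-passages is one arc. -/
def Arc (D : GaussDiagram n) : Type := Quot D.ArcStep

/-- The arc that contains a given short arc. -/
def arcOf (D : GaussDiagram n) (s : D.ShortArc) : D.Arc := Quot.mk _ s

instance (D : GaussDiagram n) : Finite D.Arc :=
  inferInstanceAs (Finite (Quot D.ArcStep))

/-! ### The `Zh`-construction -/

/-- The choices made when the component `ω` is drawn around `D`. -/
structure OmegaChoice (D : GaussDiagram n) where
  /-- whether `ω` passes to the right (`true`) or to the left (`false`) of a positive crossing;
  for a negative crossing it is the other way round -/
  side : D.Crossing → Bool
  /-- the order in which `ω` runs through its over-passages, one on each strand at each crossing -/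
  tour : List D.Endpoint
  nodup_tour : tour.Nodup
  mem_tour : ∀ e, e ∈ tour

/-- The sign of the crossing in which `ω` passes over `D` next to the endpoint `e`: next to a
crossing `c` of `D` it is the sign of `c` on the under-strand and its opposite on the
over-strand. -/
def omegaSign (D : GaussDiagram n) : D.Endpoint → ℤˣ
  | (c, .under) => D.sign c
  | (c, .over) => -D.sign c

/-- Whether `ω` crosses the strand of `D` just before the endpoint `e` (rather than just after).
It crosses two of the four short arcs at a crossing: either the incoming under-arc and the outgoing
over-arc, or the incoming over-arc and the outgoing under-arc. These are the two arcs on one side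
of the crossing. -/
def OmegaChoice.before {D : GaussDiagram n} (ω : D.OmegaChoice) : D.Endpoint → Bool
  | (c, .under) => ω.side c
  | (c, .over) => !ω.side c

/-- The endpoint `e` of `D` together with the new under-passage of `D` below `ω` next to it. The
crossing of `ω` with `D` next to `e` is named `Sum.inr e`. -/
def OmegaChoice.block {D : GaussDiagram n} (ω : D.OmegaChoice) (e : D.Endpoint) :
    List ((D.Crossing ⊕ D.Endpoint) × Strand) :=
  if ω.before e then [(Sum.inr e, .under), (Sum.inl e.1, e.2)]
  else [(Sum.inl e.1, e.2), (Sum.inr e, .under)]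

theorem OmegaChoice.mem_block {D : GaussDiagram n} (ω : D.OmegaChoice) (e : D.Endpoint)
    (x : (D.Crossing ⊕ D.Endpoint) × Strand) :
    x ∈ ω.block e ↔ x = (Sum.inr e, .under) ∨ x = (Sum.inl e.1, e.2) := by
  unfold OmegaChoice.block
  split <;> simp [or_comm]

theorem OmegaChoice.nodup_block {D : GaussDiagram n} (ω : D.OmegaChoice) (e : D.Endpoint) :
    (ω.block e).Nodup := by
  unfold OmegaChoice.block
  split <;> simp

/-- The component of `Zh(D)` that contains an endpoint; `ω` is the last component. -/
def zhComp (D : GaussDiagram n) : (D.Crossing ⊕ D.Endpoint) × Strand → Fin (n + 1)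
  | (Sum.inl c, t) => (D.comp (c, t)).castSucc
  | (Sum.inr e, .under) => (D.comp e).castSucc
  | (Sum.inr _, .over) => Fin.last n

/-- The diagram `Zh(D)`, drawn with the choices `ω`: a new last component `ω` is added to `D`. It
has two over-passages next to each classical crossing of `D`, and no under-passages. -/
def zh (D : GaussDiagram n) (ω : D.OmegaChoice) : GaussDiagram (n + 1) where
  Crossing := D.Crossing ⊕ D.Endpoint
  sign := Sum.elim D.sign D.omegaSign
  word := Fin.lastCases (ω.tour.map fun e => (Sum.inr e, .over))
    (fun i => (D.word i).flatMap ω.block)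
  comp := D.zhComp
  mem_word := by
    intro x i
    induction i using Fin.lastCases with
    | last =>
      rw [Fin.lastCases_last]
      rcases x with ⟨c | e, t⟩
      · simp [zhComp, Fin.castSucc_ne_last]
      · cases t <;> simp [zhComp, ω.mem_tour, Fin.castSucc_ne_last]
    | cast i =>
      rw [Fin.lastCases_castSucc]
      simp only [List.mem_flatMap, OmegaChoice.mem_block, D.mem_word]
      rcases x with ⟨c | e, t⟩
      · simp [zhComp, Prod.ext_iff]
      · cases t
        · simp [zhComp, (Fin.castSucc_ne_last i).symm]
        · simp [zhComp]
  nodup := by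
    intro i
    induction i using Fin.lastCases with
    | last =>
      rw [Fin.lastCases_last]
      exact ω.nodup_tour.map fun a b h => by simpa using h
    | cast i =>
      rw [Fin.lastCases_castSucc, List.nodup_flatMap]
      refine ⟨fun e _ => ω.nodup_block e, (D.nodup i).imp fun {a b} hab x ha hb => hab ?_⟩
      rw [OmegaChoice.mem_block] at ha hb
      rcases ha with rfl | rfl <;> rcases hb with hb | hb
      · simpa using hb
      · simp at hb
      · simp at hb
      · simpa [Prod.ext_iff] using hb

end GaussDiagram

/-! ### Quandles by generators and relations

The quandle operation `x * y` of knot theory is written `y ◃ x` here (`y` acts on `x`), and its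
inverse is `y ◃⁻¹ x`. -/

/-- Formal quandle words in the generators `S`. -/
inductive QuandleWord (S : Type u) : Type u
  | gen (s : S)
  | act (x y : QuandleWord S)
  | invAct (x y : QuandleWord S)

/-- The congruence on quandle words generated by the quandle axioms and by the relations
`s ◃ t = w`, for all triples of generators with `R s t w`. -/
inductive QuandleWord.Rel {S : Type u} (R : S → S → S → Prop) :
    QuandleWord S → QuandleWord S → Prop
  | refl (x) : Rel R x x
  | symm {x y} : Rel R x y → Rel R y x
  | trans {x y z} : Rel R x y → Rel R y z → Rel R x z
  | congrAct {x x' y y'} : Rel R x x' → Rel R y y' → Rel R (act x y) (act x' y')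
  | congrInvAct {x x' y y'} : Rel R x x' → Rel R y y' → Rel R (invAct x y) (invAct x' y')
  | selfDistrib (x y z) : Rel R (act x (act y z)) (act (act x y) (act x z))
  | invActAct (x y) : Rel R (invAct x (act x y)) y
  | actInvAct (x y) : Rel R (act x (invAct x y)) y
  | fix (x) : Rel R (act x x) x
  | rel {s t w} : R s t w → Rel R (act (gen s) (gen t)) (gen w)

/-- The setoid of `QuandleWord.Rel`. -/
def QuandleWord.setoid {S : Type u} (R : S → S → S → Prop) : Setoid (QuandleWord S) :=
  ⟨QuandleWord.Rel R, QuandleWord.Rel.refl, QuandleWord.Rel.symm, QuandleWord.Rel.trans⟩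

/-- The quandle with generators `S` and relations `s ◃ t = w` whenever `R s t w`. -/
def PresentedQuandle {S : Type u} (R : S → S → S → Prop) : Type u :=
  Quotient (QuandleWord.setoid R)

namespace PresentedQuandle

variable {S : Type u} {R : S → S → S → Prop}

/-- The class of a word. -/
def mk (R : S → S → S → Prop) (w : QuandleWord S) : PresentedQuandle R :=
  Quotient.mk (QuandleWord.setoid R) w

/-- The class of a generator. -/
def of (R : S → S → S → Prop) (s : S) : PresentedQuandle R := mk R (.gen s)

instance : Quandle (PresentedQuandle R) where
  act := Quotient.map₂ QuandleWord.act fun _ _ hx _ _ hy => QuandleWord.Rel.congrAct hx hy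
  self_distrib := by
    rintro ⟨x⟩ ⟨y⟩ ⟨z⟩
    exact Quotient.sound (QuandleWord.Rel.selfDistrib x y z)
  invAct := Quotient.map₂ QuandleWord.invAct fun _ _ hx _ _ hy => QuandleWord.Rel.congrInvAct hx hy
  left_inv := by
    rintro ⟨x⟩ ⟨y⟩
    exact Quotient.sound (QuandleWord.Rel.invActAct x y)
  right_inv := by
    rintro ⟨x⟩ ⟨y⟩
    exact Quotient.sound (QuandleWord.Rel.actInvAct x y)
  fix := by
    rintro ⟨x⟩
    exact Quotient.sound (QuandleWord.Rel.fix x)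

/-- A homomorphism is determined by its values on the generators. -/
theorem hom_ext {X : Type v} [Quandle X] {f g : PresentedQuandle R →◃ X}
    (h : ∀ s, f (of R s) = g (of R s)) : f = g := by
  have key : ∀ w : QuandleWord S, f (mk R w) = g (mk R w) := by
    intro w
    induction w with
    | gen s => exact h s
    | act x y hx hy =>
      have e : mk R (.act x y) = mk R x ◃ mk R y := rfl
      rw [e, ShelfHom.map_act, ShelfHom.map_act, hx, hy]
    | invAct x y hx hy =>
      have e : mk R x ◃ mk R (.invAct x y) = mk R y :=
        Quotient.sound (QuandleWord.Rel.actInvAct x y)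
      have h1 := congrArg f e
      have h2 := congrArg g e
      rw [ShelfHom.map_act] at h1 h2
      rw [← hx] at h2
      exact (Rack.left_cancel _).1 (h1.trans (hy.trans h2.symm))
  apply ShelfHom.ext
  funext q
  induction q using Quotient.inductionOn with
  | _ w => exact key w

instance {X : Type v} [Quandle X] [Finite S] [Finite X] : Finite (PresentedQuandle R →◃ X) :=
  Finite.of_injective (fun f s => f (of R s)) fun _ _ h => hom_ext fun s => congrFun h s

end PresentedQuandle

/-! ### Fundamental quandle, colorings and cocycle invariants -/

namespace GaussDiagram

variable {n : ℕ}

/-- The arc that passes over the crossing `c`. -/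
def overArc (D : GaussDiagram n) (c : D.Crossing) : D.Arc :=
  D.arcOf (D.outgoing (c, .over))

/-- The under-arc to the right of the over-strand at `c`: the incoming one at a positive crossing,
the outgoing one at a negative crossing. -/
def sourceArc (D : GaussDiagram n) (c : D.Crossing) : D.Arc :=
  if D.sign c = 1 then D.arcOf (D.incoming (c, .under)) else D.arcOf (D.outgoing (c, .under))

/-- The under-arc to the left of the over-strand at `c`: the outgoing one at a positive crossing,
the incoming one at a negative crossing. -/
def targetArc (D : GaussDiagram n) (c : D.Crossing) : D.Arc :=
  if D.sign c = 1 then D.arcOf (D.outgoing (c, .under)) else D.arcOf (D.incoming (c, .under))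

/-- The crossing relations `source * over = target`. -/
inductive CrossingRel (D : GaussDiagram n) : D.Arc → D.Arc → D.Arc → Prop
  | mk (c : D.Crossing) : CrossingRel D (D.overArc c) (D.sourceArc c) (D.targetArc c)

/-- The fundamental quandle `Q(D)`: generated by the arcs, with one relation per crossing. -/
abbrev FundamentalQuandle (D : GaussDiagram n) : Type := PresentedQuandle D.CrossingRel

/-- The set of colorings of `D` by `X`. -/
abbrev Coloring (D : GaussDiagram n) (X : Type u) [Quandle X] : Type u :=
  D.FundamentalQuandle →◃ X

/-- The color of an arc. -/
def Coloring.color {D : GaussDiagram n} {X : Type u} [Quandle X] (χ : D.Coloring X)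
    (a : D.Arc) : X :=
  χ (PresentedQuandle.of D.CrossingRel a)

noncomputable instance (D : GaussDiagram n) (X : Type u) [Quandle X] [Finite X] :
    Fintype (D.Coloring X) :=
  Fintype.ofFinite _

/-- The extended colorings of `D` by `X`: colorings of `Zh(D)`. -/
abbrev ExtendedColoring (D : GaussDiagram n) (ω : D.OmegaChoice) (X : Type u) [Quandle X] :
    Type u :=
  (D.zh ω).Coloring X

end GaussDiagram

/-- Quandle 2-cocycles with values in a multiplicative abelian group:
`φ(x,z) φ(x*z,y*z) = φ(x*y,z) φ(x,y)` and `φ(x,x) = 1`. -/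
structure IsQuandleTwoCocycle {X : Type u} [Quandle X] {A : Type v} [CommGroup A]
    (φ : X → X → A) : Prop where
  cocycle : ∀ x y z : X, φ x z * φ (z ◃ x) (z ◃ y) = φ (y ◃ x) z * φ x y
  diag : ∀ x : X, φ x x = 1

namespace GaussDiagram

variable {n : ℕ}

/-- The Boltzmann weight of a crossing: `φ(source, over)` to the power of the crossing sign. -/
def boltzmannWeight (D : GaussDiagram n) {X : Type u} [Quandle X] {A : Type v} [CommGroup A]
    (φ : X → X → A) (χ : D.Coloring X) (c : D.Crossing) : A :=
  φ (χ.color (D.sourceArc c)) (χ.color (D.overArc c)) ^ (D.sign c : ℤ)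

/-- The cocycle counting invariant, an element of the integral group ring `ℤ[A]`. -/
noncomputable def cocycleInvariant (D : GaussDiagram n) {X : Type u} [Quandle X] [Finite X]
    {A : Type v} [CommGroup A] (φ : X → X → A) : MonoidAlgebra ℤ A :=
  ∑ χ : D.Coloring X, MonoidAlgebra.of ℤ A (∏ c : D.Crossing, D.boltzmannWeight φ χ c)

/-- The extended cocycle counting invariant. -/
noncomputable def extendedCocycleInvariant (D : GaussDiagram n) (ω : D.OmegaChoice)
    {X : Type u} [Quandle X] [Finite X] {A : Type v} [CommGroup A] (φ : X → X → A) :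
    MonoidAlgebra ℤ A :=
  (D.zh ω).cocycleInvariant φ

end GaussDiagram

/-! The proof turns the invariant into a state sum with a twist parameter. Let a finite quandle `X`
act on `ℤ[A]^X`: `proj x` is the projection to the basis vector `x`, and `act y` is the monomial
matrix of `x ↦ y ◃ x` with weights `φ x y`. The cocycle condition says exactly that the `act`
matrices conjugate each other as in the quandle, and `φ x x = 1` gives `proj x * act x = proj x`.
Choose also a unit `t`, the twist, whose conjugation permutes the `proj x` and the `act x` by one
permutation of `X`. At a crossing of sign `ε` with over-colour `y`, the over-passage carries `proj y
* t ^ (-ε)` and the under-passage `t ^ ε * act y ^ ε`. Multiplying along each circle, taking traces,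
and summing over all over-colours gives `stateSum`.

Three facts carry the theorem. For every twist, the state sum is invariant under the Reidemeister
moves (`VirtualEquiv.stateSum_eq`). For `t = 1`, expanding the traces gives the cocycle invariant
(`cocycleInvariant_eq_stateSum`). In the untwisted state sum of `Zh(D)`, the component `ω` has only
over-passages, so its trace forces one colour `w` on all of it; its crossings with `D` then insert
`act w ^ (±1)` next to each passage, which is the twist `t = act w`. Hence the invariant of `Zh(D)`
is the sum over `w` of the state sums of `D` twisted by `act w` (`stateSum_zh`).

On an Alexander numbered diagram, conjugating by `t ^ f` on each short arc, where `f` is the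
numbering, removes the twist (`stateSum_eq_untwist`). By invariance the twist is also invisible on
every almost classical diagram, so all `|X|` summands equal the invariant of `D`. The coloring count
is the case of the trivial cocycle. -/

namespace GaussDiagram

variable {n : ℕ}

/-! ### Loop products -/

section LoopProduct

variable {X : Type*} [Fintype X] [DecidableEq X] {R : Type*} [CommRing R]

/-- The product over all circles of the traces of the products of the matrices met on them. -/
def loopProduct (D : GaussDiagram n) (L : D.Endpoint → Matrix X X R) : R :=
  ∏ i, ((D.word i).map L).prod.trace

theorem trace_prod_map_eq_of_isRotated {α : Type*} {l l' : List α} (h : l ~r l')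
    (L : α → Matrix X X R) : (l.map L).prod.trace = (l'.map L).prod.trace := by
  obtain ⟨k, rfl⟩ := h
  rw [← List.rotate_mod]
  rcases Nat.eq_zero_or_pos l.length with h0 | h0
  · simp [List.length_eq_zero_iff.1 h0]
  rw [List.rotate_eq_drop_append_take (Nat.mod_lt _ h0).le, List.map_append, List.prod_append,
    Matrix.trace_mul_comm, ← List.prod_append, ← List.map_append, List.take_append_drop]

/-- The loop product depends on two adjacent letters only through their matrix product, and linearly
so. This reduces each Reidemeister move to a matrix identity on each strand involved. -/
theorem loopProduct_pair_sum (D : GaussDiagram n) {Y : Type*} [Fintype Y] {p q : D.Endpoint}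
    (hpq : D.Consecutive p q) (L : D.Endpoint → Matrix X X R)
    (M : Y → D.Endpoint → Matrix X X R) (hmul : L p * L q = ∑ y, M y p * M y q)
    (hM : ∀ y e, e ≠ p → e ≠ q → M y e = L e) :
    D.loopProduct L = ∑ y, D.loopProduct (M y) := by
  obtain ⟨i, l, hl⟩ := hpq
  have hnd := hl.nodup_iff.1 (D.nodup i)
  have hp : D.comp p = i := (D.mem_word _ _).1 (hl.mem_iff.2 (by simp))
  have hq : D.comp q = i := (D.mem_word _ _).1 (hl.mem_iff.2 (by simp))
  have key : ∀ y j, j ≠ i → (D.word j).map (M y) = (D.word j).map L := by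
    intro y j hj
    refine List.map_congr_left fun e he => hM y e ?_ ?_ <;> rintro rfl
    · exact hj (((D.mem_word _ _).1 he).symm.trans hp)
    · exact hj (((D.mem_word _ _).1 he).symm.trans hq)
  have key2 : ∀ y, l.map (M y) = l.map L := by
    intro y
    refine List.map_congr_left fun e he => hM y e ?_ ?_ <;> rintro rfl
    · simp [he] at hnd
    · simp [he] at hnd
  unfold loopProduct
  simp only [← Finset.mul_prod_erase _ _ (Finset.mem_univ i)]
  have h2 : ∀ y, ∏ j ∈ Finset.univ.erase i, ((D.word j).map (M y)).prod.trace
      = ∏ j ∈ Finset.univ.erase i, ((D.word j).map L).prod.trace := fun y =>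
    Finset.prod_congr rfl fun j hj => by rw [key y j (Finset.ne_of_mem_erase hj)]
  simp only [h2, ← Finset.sum_mul]
  congr 1
  simp only [trace_prod_map_eq_of_isRotated hl, List.map_cons, List.prod_cons, key2, ← mul_assoc]
  rw [hmul, Finset.sum_mul, Matrix.trace_sum]

theorem loopProduct_congr_pair (D : GaussDiagram n) {p q : D.Endpoint}
    (hpq : D.Consecutive p q) (L M : D.Endpoint → Matrix X X R) (hmul : L p * L q = M p * M q)
    (hM : ∀ e, e ≠ p → e ≠ q → M e = L e) :
    D.loopProduct L = D.loopProduct M := by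
  simpa using D.loopProduct_pair_sum hpq L (fun _ : Unit => M) (by simpa using hmul)
    (fun _ => hM)

theorem loopProduct_eq_zero (D : GaussDiagram n) {p q : D.Endpoint}
    (hpq : D.Consecutive p q) (L : D.Endpoint → Matrix X X R) (hmul : L p * L q = 0) :
    D.loopProduct L = 0 := by
  simpa using D.loopProduct_pair_sum hpq L (fun y : Empty => y.elim) (by simpa using hmul)
    (fun y => y.elim)

theorem loopProduct_eq_of_word_eq_map {D D' : GaussDiagram n} (f : D.Endpoint → D'.Endpoint)
    (σ : Equiv.Perm (Fin n)) (h : ∀ i, D'.word (σ i) ~r (D.word i).map f)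
    (L : D'.Endpoint → Matrix X X R) : D'.loopProduct L = D.loopProduct (L ∘ f) := by
  unfold loopProduct
  rw [← Equiv.prod_comp σ]
  refine Finset.prod_congr rfl fun i _ => ?_
  rw [trace_prod_map_eq_of_isRotated (h i), List.map_map]

/-- Erasing an endpoint amounts to placing the identity matrix there, so both sides of a move can be
compared on the words of `D`. -/
theorem loopProduct_erasure {D D' : GaussDiagram n} {S : Finset D.Crossing}
    {g : D'.Crossing → D.Crossing} (hg : Function.Injective g)
    (hS : ∀ c, c ∈ Set.range g ↔ c ∉ S)
    (hw : ∀ i, (D'.word i).map (Prod.map g id) = (D.word i).filter (fun e => e.1 ∉ S))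
    (L : D'.Endpoint → Matrix X X R) :
    D'.loopProduct L = D.loopProduct (Function.extend (Prod.map g id) L 1) := by
  unfold loopProduct
  refine Finset.prod_congr rfl fun i _ => ?_
  have h1 : (D'.word i).map L
      = ((D.word i).filter (fun e => e.1 ∉ S)).map (Function.extend (Prod.map g id) L 1) := by
    rw [← hw, List.map_map]
    refine List.map_congr_left fun e _ => ?_
    exact ((hg.prodMap Function.injective_id).extend_apply L 1 e).symm
  rw [h1]
  congr 1
  induction D.word i with
  | nil => rfl
  | cons e l ih =>
    by_cases he : e.1 ∈ S
    · rw [List.filter_cons_of_neg (by simpa using he), List.map_cons, List.prod_cons, ih,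
        Function.extend_apply', Pi.one_apply, one_mul]
      rintro ⟨a, rfl⟩
      exact (hS _).1 ⟨a.1, rfl⟩ he
    · rw [List.filter_cons_of_pos (by simpa using he), List.map_cons, List.prod_cons, ih,
        List.map_cons, List.prod_cons]

end LoopProduct

end GaussDiagram

/-! ### Twisted representations of a quandle -/

/-- A family of orthogonal idempotents indexed by a quandle `X`, together with actions of the
elements of `X` and of one automorphism of `X` by units that permute the idempotents. -/
structure TwistedRep (X : Type*) [Quandle X] [Fintype X] [DecidableEq X] (M : Type*) [Ring M] where
  proj : X → M
  act : X → Mˣ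
  twist : Mˣ
  perm : Equiv.Perm X
  proj_mul_proj : ∀ x y, proj x * proj y = if x = y then proj x else 0
  sum_proj : ∑ x, proj x = 1
  proj_mul_act : ∀ x z, proj x * act z = act z * proj (z ◃ x)
  act_mul_act : ∀ x z, act x * act z = act z * act (z ◃ x)
  proj_mul_twist : ∀ x, proj x * twist = twist * proj (perm x)
  act_mul_twist : ∀ x, act x * twist = twist * act (perm x)
  proj_mul_act_self : ∀ x, proj x * act x = proj x

namespace TwistedRep

variable {X : Type*} [Quandle X] [Fintype X] [DecidableEq X] {M : Type*} [Ring M]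
  (ρ : TwistedRep X M)

theorem mul_zpow_of_comm_perm {ι : Type*} (a : ι → M) (σ : Equiv.Perm ι) (t : Mˣ)
    (h : ∀ x, a x * t = t * a (σ x)) (k : ℤ) (x : ι) :
    a x * ↑(t ^ k) = ↑(t ^ k) * a ((σ ^ k) x) := by
  have h' : ∀ x, a x * ↑t⁻¹ = ↑t⁻¹ * a (σ⁻¹ x) := fun x => by
    rw [Units.mul_inv_eq_iff_eq_mul, mul_assoc, h]
    simp
  induction k generalizing x with
  | zero => simp
  | succ k ih =>
    rw [zpow_add_one, add_comm (k : ℤ) 1, zpow_one_add, Units.val_mul, ← mul_assoc, ih, mul_assoc,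
      h, mul_assoc, Equiv.Perm.mul_apply]
  | pred k ih =>
    rw [zpow_sub_one, sub_eq_neg_add, zpow_add, zpow_neg_one, Units.val_mul, ← mul_assoc, ih,
      mul_assoc, h', mul_assoc, Equiv.Perm.mul_apply]

theorem proj_mul_twist_zpow (k : ℤ) (x : X) :
    ρ.proj x * ↑(ρ.twist ^ k) = ↑(ρ.twist ^ k) * ρ.proj ((ρ.perm ^ k) x) :=
  mul_zpow_of_comm_perm _ _ _ ρ.proj_mul_twist k x

theorem act_mul_twist_zpow (k : ℤ) (x : X) :
    ρ.act x * ρ.twist ^ k = ρ.twist ^ k * ρ.act ((ρ.perm ^ k) x) :=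
  Units.ext <| mul_zpow_of_comm_perm (fun x => (ρ.act x : M)) _ _
    (fun x => by simpa using congrArg Units.val (ρ.act_mul_twist x)) k x

theorem proj_mul_act_zpow (k : ℤ) (x z : X) :
    ρ.proj x * ↑(ρ.act z ^ k) = ↑(ρ.act z ^ k) * ρ.proj ((Rack.act' z ^ k) x) :=
  mul_zpow_of_comm_perm _ _ _ (fun x => ρ.proj_mul_act x z) k x

theorem act_zpow_mul_twist_zpow (k m : ℤ) (x : X) :
    ρ.act x ^ m * ρ.twist ^ k = ρ.twist ^ k * ρ.act ((ρ.perm ^ k) x) ^ m :=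
  (SemiconjBy.zpow_right (a := ρ.twist ^ k) (ρ.act_mul_twist_zpow k x).symm m).symm

theorem act_perm (x : X) : ρ.act (ρ.perm x) = ρ.twist⁻¹ * ρ.act x * ρ.twist := by
  rw [mul_assoc, ρ.act_mul_twist, inv_mul_cancel_left]

theorem act_perm_symm (x : X) : ρ.act (ρ.perm.symm x) = ρ.twist * ρ.act x * ρ.twist⁻¹ := by
  have := ρ.act_perm (ρ.perm.symm x)
  rw [Equiv.apply_symm_apply] at this
  rw [this]
  group

theorem act_act (x z : X) : ρ.act (z ◃ x) = (ρ.act z)⁻¹ * ρ.act x * ρ.act z := by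
  rw [mul_assoc, ρ.act_mul_act, inv_mul_cancel_left]

theorem act_invAct (x z : X) : ρ.act (z ◃⁻¹ x) = ρ.act z * ρ.act x * (ρ.act z)⁻¹ := by
  have := ρ.act_act (z ◃⁻¹ x) z
  rw [Rack.right_inv] at this
  rw [this]
  group

/-- The matrix of an over-passage with colour `y`. -/
def overOp (ε : ℤˣ) (y : X) : M := ρ.proj y * ↑(ρ.twist ^ (-ε : ℤ))

/-- The matrix of an under-passage below an arc with colour `y`. -/
def underOp (ε : ℤˣ) (y : X) : Mˣ := ρ.twist ^ (ε : ℤ) * ρ.act y ^ (ε : ℤ)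

/-- The effect of an under-passage on colours. -/
def underPerm (ε : ℤˣ) (y : X) : Equiv.Perm X := Rack.act' y ^ (ε : ℤ) * ρ.perm ^ (ε : ℤ)

/-- An under-passage permutes the idempotents; `underPerm` records how a colour changes when the
strand goes under. -/
theorem proj_mul_under (ε : ℤˣ) (x y : X) :
    ρ.proj x * ρ.underOp ε y = ρ.underOp ε y * ρ.proj (ρ.underPerm ε y x) := by
  rw [underOp, underPerm, Units.val_mul, ← mul_assoc, proj_mul_twist_zpow, mul_assoc,
    proj_mul_act_zpow, mul_assoc, Equiv.Perm.mul_apply]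

theorem proj_mul_act_self_zpow (ε : ℤˣ) (x : X) : ρ.proj x * ↑(ρ.act x ^ (ε : ℤ)) = ρ.proj x := by
  rcases Int.units_eq_one_or ε with rfl | rfl
  · simpa using ρ.proj_mul_act_self x
  · simpa [Units.mul_inv_eq_iff_eq_mul] using (ρ.proj_mul_act_self x).symm

/-- A kink: the twists cancel and `act y` is invisible next to `proj y`. Summing over `y` leaves the
identity, which is the first move. -/
theorem over_mul_under_self (ε : ℤˣ) (y : X) : ρ.overOp ε y * ρ.underOp ε y = ρ.proj y := by
  rw [overOp, underOp, mul_assoc, ← Units.val_mul, zpow_neg, inv_mul_cancel_left,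
    proj_mul_act_self_zpow]

omit [Fintype X] [DecidableEq X] in
theorem act_zpow_self (x : X) (k : ℤ) : (Rack.act' x ^ k) x = x :=
  Function.IsFixedPt.perm_zpow (e := Rack.act' x) (show x ◃ x = x from Quandle.fix) k

theorem sum_under_mul_over_self (ε : ℤˣ) : ∑ y, ↑(ρ.underOp ε y) * ρ.overOp ε y = 1 := by
  have h : ∀ y, ↑(ρ.underOp ε y) * ρ.overOp ε y
      = ↑(ρ.twist ^ (ε : ℤ)) * ρ.proj y * ↑(ρ.twist ^ (-ε : ℤ)) := by
    intro y
    have h1 := ρ.proj_mul_act_zpow ε y y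
    rw [act_zpow_self] at h1
    rw [overOp, underOp, Units.val_mul, mul_assoc, ← mul_assoc _ (ρ.proj y), ← h1,
      proj_mul_act_self_zpow, mul_assoc]
  simp only [h]
  rw [← Finset.sum_mul, ← Finset.mul_sum, sum_proj, mul_one, ← Units.val_mul, ← zpow_add]
  simp

/-- Orthogonality of the idempotents: consecutive over-colours must agree up to the twist picked up
between them. For opposite signs the twists cancel and `proj x` remains, as the second move
requires. -/
theorem over_mul_over (α β : ℤˣ) (x z : X) :
    ρ.overOp β x * ρ.overOp α z =
      if z = (ρ.perm ^ (-β : ℤ)) x then ρ.proj x * ↑(ρ.twist ^ (-β - α : ℤ)) else 0 := by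
  have h : ρ.overOp β x * ρ.overOp α z
      = ρ.twist ^ (-β : ℤ) • ((ρ.proj ((ρ.perm ^ (-β : ℤ)) x) * ρ.proj z)
        * ↑(ρ.twist ^ (-α : ℤ))) := by
    rw [overOp, overOp, proj_mul_twist_zpow, Units.smul_def, smul_eq_mul]
    simp only [mul_assoc]
  rw [h, proj_mul_proj]
  by_cases hz : z = (ρ.perm ^ (-β : ℤ)) x
  · rw [if_pos hz.symm, if_pos hz, Units.smul_def, smul_eq_mul, ← mul_assoc,
      ← proj_mul_twist_zpow, mul_assoc, ← Units.val_mul, ← zpow_add, sub_eq_add_neg]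
  · rw [if_neg (Ne.symm hz), if_neg hz, zero_mul, smul_zero]

theorem under_mul_under_neg (ε : ℤˣ) (y : X) :
    ρ.underOp ε y * ρ.underOp (-ε) ((ρ.perm ^ (-ε : ℤ)) y) = 1 := by
  rcases Int.units_eq_one_or ε with rfl | rfl
  · simp [underOp, act_perm_symm, mul_assoc]
  · simp [underOp, act_perm, mul_assoc]

/-- An over-passage slides past an under-passage, each changing the colour of the other. This is the
middle strand in the third move. -/
theorem over_mul_under (α γ : ℤˣ) (y z : X) :
    ρ.overOp γ y * ρ.underOp α z = ρ.underOp α ((ρ.perm ^ (γ : ℤ)) z) *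
      ρ.overOp γ (ρ.underPerm α ((ρ.perm ^ (γ : ℤ)) z) y) := by
  rw [overOp, overOp, ← mul_assoc, ← proj_mul_under, mul_assoc, mul_assoc, ← Units.val_mul,
    ← Units.val_mul]
  congr 2
  rw [underOp, underOp, mul_assoc, act_zpow_mul_twist_zpow, ← Equiv.Perm.mul_apply, ← zpow_add,
    neg_add_cancel, zpow_zero, Equiv.Perm.one_apply, ← mul_assoc, ← mul_assoc, ← zpow_add,
    ← zpow_add, add_comm]

/-- The third Reidemeister move on its bottom strand. -/
theorem under_mul_under_of_triangle (s α β γ : ℤˣ) {a b c a' b' c' : X}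
    (hs : β = -s → a = (ρ.perm ^ (-β : ℤ)) b) (hs' : β = s → b = (ρ.perm ^ (-α : ℤ)) a)
    (ha : a' = (ρ.perm ^ (-s : ℤ)) a) (hb : b' = (ρ.perm ^ (s * α * β : ℤ)) b)
    (hc : γ = -s → c' = ρ.underPerm α a' c) (hc' : γ = s → c = ρ.underPerm α a c') :
    if s * α * β * γ = 1 then ρ.underOp β b * ρ.underOp γ c = ρ.underOp γ c' * ρ.underOp β b'
    else ρ.underOp γ c * ρ.underOp β b = ρ.underOp β b' * ρ.underOp γ c' := by
  have hi : ∀ x y : X, (Rack.act' x)⁻¹ y = x ◃⁻¹ y := fun _ _ => rfl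
  have hj : ∀ x y : X, (Rack.act' x) y = x ◃ y := fun _ _ => rfl
  -- In each of the sixteen sign patterns, the colour relations leave an identity between words in
  -- `twist` and `act`, settled by rewriting every permuted or acted-on colour as a conjugate.
  rcases Int.units_eq_one_or s with rfl | rfl <;> rcases Int.units_eq_one_or α with rfl | rfl <;>
  rcases Int.units_eq_one_or β with rfl | rfl <;> rcases Int.units_eq_one_or γ with rfl | rfl <;>
  simp [units_ne_neg_self, neg_units_ne_self, underPerm, hi, hj] at * <;> subst_vars <;>
  simp [underOp, act_perm, act_perm_symm, act_act, act_invAct, mul_assoc]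

end TwistedRep

namespace GaussDiagram

variable {n : ℕ}

/-! ### The state sum and the first two Reidemeister moves -/

section StateSum

variable {X : Type*} [Quandle X] [Fintype X] [DecidableEq X] {R : Type*} [CommRing R]
  (ρ : TwistedRep X (Matrix X X R))

/-- The matrix of a passage, given the colours of the incoming over-arcs. -/
def passage (D : GaussDiagram n) (v : D.Crossing → X) : D.Endpoint → Matrix X X R
  | (c, .over) => ρ.overOp (D.sign c) (v c)
  | (c, .under) => ρ.underOp (D.sign c) (v c)

/-- The state sum of a diagram. -/
def stateSum (D : GaussDiagram n) : R :=
  ∑ v : D.Crossing → X, D.loopProduct (D.passage ρ v)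

variable {ρ}

theorem Iso.stateSum_eq {D D' : GaussDiagram n} (h : D.Iso D') :
    D.stateSum ρ = D'.stateSum ρ := by
  obtain ⟨g, σ, hs, hw⟩ := h
  unfold stateSum
  refine (Fintype.sum_equiv (Equiv.arrowCongr g.symm (Equiv.refl X)) _ _ fun v => ?_).symm
  rw [loopProduct_eq_of_word_eq_map _ σ hw]
  congr 1
  funext ⟨c, t⟩
  cases t <;> simp [passage, hs]

/-- Common frame for the first two moves. `η y` lists the colours of the erased crossings once `c`
has colour `y`; all other colourings contribute zero, and summing over `y` must leave identity
matrices at the erased endpoints. -/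
theorem stateSum_eq_of_erasure {D D' : GaussDiagram n} {S : Finset D.Crossing}
    (h : D.IsErasure D' S) {c : D.Crossing} (hc : c ∈ S) (η : X → D.Crossing → X)
    (hη : ∀ y, η y c = y)
    (hzero : ∀ v, (∃ d ∈ S, v d ≠ η (v c) d) → D.loopProduct (D.passage ρ v) = 0)
    (hsum : ∀ (L : D.Endpoint → Matrix X X R) (v : X → D.Crossing → X),
      (∀ y, ∀ d ∈ S, v y d = η y d) → (∀ e, e.1 ∈ S → L e = 1) →
      (∀ y e, e.1 ∉ S → D.passage ρ (v y) e = L e) →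
      D.loopProduct L = ∑ y, D.loopProduct (D.passage ρ (v y))) :
    D.stateSum ρ = D'.stateSum ρ := by
  obtain ⟨g, hg, hS, hs, hw⟩ := h
  have hext : ∀ (w : D'.Crossing → X) (y : X), ∀ d ∈ S, Function.extend g w (η y) d = η y d :=
    fun w y d hd => Function.extend_apply' _ _ _ fun ⟨a, ha⟩ => (hS d).1 ⟨a, ha⟩ hd
  have key : ∀ w : D'.Crossing → X, D'.loopProduct (D'.passage ρ w)
      = ∑ y, D.loopProduct (D.passage ρ (Function.extend g w (η y))) := by
    intro w
    rw [loopProduct_erasure hg hS hw]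
    refine hsum _ _ (hext w) ?_ ?_
    · intro e he
      rw [Function.extend_apply', Pi.one_apply]
      rintro ⟨a, rfl⟩
      exact (hS _).1 ⟨a.1, rfl⟩ he
    · rintro y ⟨d, t⟩ he
      obtain ⟨d, rfl⟩ := (hS d).2 he
      have := (hg.prodMap Function.injective_id).extend_apply (D'.passage ρ w) 1 (d, t)
      rw [Prod.map_apply, id] at this
      rw [this]
      cases t <;> simp [passage, hs, hg.extend_apply]
  unfold stateSum
  simp only [key]
  rw [← Fintype.sum_prod_type']
  symm
  refine Finset.sum_of_injOn (fun x : (D'.Crossing → X) × X => Function.extend g x.1 (η x.2))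
    ?_ (by simp) ?_ (fun _ _ => rfl)
  · rintro ⟨w, y⟩ - ⟨w', y'⟩ - h
    have h1 : w = w' := by
      funext a
      simpa [hg.extend_apply] using congrFun h (g a)
    have h2 : y = y' := by
      have := congrFun h c
      simpa only [hext _ _ _ hc, hη] using this
    rw [h1, h2]
  · intro v _ hv
    apply hzero
    by_contra! hcon
    refine hv ⟨(v ∘ g, v c), by simp, ?_⟩
    funext d
    by_cases hd : d ∈ S
    · exact (hext _ _ d hd).trans (hcon d hd).symm
    · obtain ⟨a, rfl⟩ := (hS d).2 hd
      simp [hg.extend_apply]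

theorem Omega1.stateSum_eq {D D' : GaussDiagram n} (h : D.Omega1 D') :
    D.stateSum ρ = D'.stateSum ρ := by
  obtain ⟨c, hc, he⟩ := h
  refine stateSum_eq_of_erasure he (Finset.mem_singleton_self c) (fun y _ => y) (fun _ => rfl)
    (by simp) fun L v hv h1 hL => ?_
  have hv' : ∀ y, v y c = y := fun y => hv y c (by simp)
  rcases hc with hc | hc
  · refine D.loopProduct_pair_sum hc L _ ?_ ?_
    · simp [h1, passage, hv', TwistedRep.over_mul_under_self, ρ.sum_proj]
    · rintro y ⟨d, t⟩ h2 h3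
      apply hL
      cases t <;> simp_all
  · refine D.loopProduct_pair_sum hc L _ ?_ ?_
    · simp [h1, passage, hv', TwistedRep.sum_under_mul_over_self]
    · rintro y ⟨d, t⟩ h2 h3
      apply hL
      cases t <;> simp_all

theorem Consecutive.ne {D : GaussDiagram n} {p q : D.Endpoint} (h : D.Consecutive p q) :
    p ≠ q := by
  obtain ⟨i, l, hl⟩ := h
  have := hl.nodup_iff.1 (D.nodup i)
  rintro rfl
  simp at this

theorem Omega2.stateSum_eq {D D' : GaussDiagram n} (h : D.Omega2 D') :
    D.stateSum ρ = D'.stateSum ρ := by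
  obtain ⟨c, d, hs, ho, hu, he⟩ := h
  have hcd : d ≠ c := fun h => ho.ne (by rw [h])
  have hs' : D.sign d = -D.sign c := by rw [hs, neg_neg]
  refine stateSum_eq_of_erasure he (Finset.mem_insert_self c _)
    (fun y k => if k = c then y else (ρ.perm ^ (-D.sign c : ℤ)) y) (fun _ => by simp) ?_ ?_
  · rintro v ⟨k, hk, hv⟩
    refine D.loopProduct_eq_zero ho _ ?_
    simp only [passage]
    rw [TwistedRep.over_mul_over, if_neg]
    simp only [Finset.mem_insert, Finset.mem_singleton] at hk
    rcases hk with rfl | rfl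
    · simp at hv
    · simpa [hcd] using hv
  · intro L v hv h1 hL
    have hvc : ∀ y, v y c = y := fun y => by simpa using hv y c (by simp)
    have hvd : ∀ y, v y d = (ρ.perm ^ (-D.sign c : ℤ)) y := fun y => by
      simpa [hcd] using hv y d (by simp)
    -- The under-strand is cancelled first, for each fixed `y`. Afterwards only the over-strand
    -- depends on `y`, so the sum over `y` can be taken there.
    let N : X → D.Endpoint → Matrix X X R := fun y e =>
      if e.2 = .under ∧ (e.1 = c ∨ e.1 = d) then 1 else D.passage ρ (v y) e
    have hN : ∀ y, D.loopProduct (D.passage ρ (v y)) = D.loopProduct (N y) := by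
      intro y
      have hmul : ρ.underOp (D.sign c) (v y c) * ρ.underOp (D.sign d) (v y d) = 1 := by
        rw [hvc, hvd, hs', TwistedRep.under_mul_under_neg]
      rcases hu with hu | hu
      · refine D.loopProduct_congr_pair hu _ _ ?_ ?_
        · simpa [passage, N] using congrArg Units.val hmul
        · rintro ⟨k, t⟩ h2 h3
          cases t <;> simp_all [N]
      · refine D.loopProduct_congr_pair hu _ _ ?_ ?_
        · simpa [passage, N] using congrArg Units.val (mul_eq_one_comm.1 hmul)
        · rintro ⟨k, t⟩ h2 h3
          cases t <;> simp_all [N]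
    simp only [hN]
    refine D.loopProduct_pair_sum ho L N ?_ ?_
    · have : ∀ y, N y (c, .over) * N y (d, .over) = ρ.proj y := by
        intro y
        simp [N, passage, TwistedRep.over_mul_over, hvc, hvd, hs']
      simp [h1, this, ρ.sum_proj]
    · rintro y ⟨k, t⟩ h2 h3
      by_cases hk : k = c ∨ k = d
      · cases t
        · simp_all
        · have : N y (k, .under) = 1 := by simp [N, hk]
          rw [this, h1 _ (by simpa using hk)]
      · have : N y (k, t) = D.passage ρ (v y) (k, t) := by simp [N, hk]
        rw [this, hL _ _ (by simpa using hk)]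

omit [Quandle X] in
theorem loopProduct_congr_ordered (D : GaussDiagram n) {p q : D.Endpoint} {s : ℤˣ}
    (hpq : D.Ordered s p q) (L M : D.Endpoint → Matrix X X R)
    (hmul : if s = 1 then L p * L q = M p * M q else L q * L p = M q * M p)
    (hM : ∀ e, e ≠ p → e ≠ q → M e = L e) :
    D.loopProduct L = D.loopProduct M := by
  unfold Ordered at hpq
  split_ifs at hpq hmul with h
  · exact D.loopProduct_congr_pair hpq L M hmul hM
  · exact D.loopProduct_congr_pair hpq L M hmul fun e h1 h2 => hM e h2 h1

omit [Quandle X] in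
theorem loopProduct_eq_zero_of_ordered (D : GaussDiagram n) {p q : D.Endpoint} {s : ℤˣ}
    (hpq : D.Ordered s p q) (L : D.Endpoint → Matrix X X R)
    (hmul : if s = 1 then L p * L q = 0 else L q * L p = 0) : D.loopProduct L = 0 := by
  unfold Ordered at hpq
  split_ifs at hpq hmul with h
  · exact D.loopProduct_eq_zero hpq L hmul
  · exact D.loopProduct_eq_zero hpq L hmul

end StateSum

end GaussDiagram

/-- The top strand in the third move. Exchanging two over-passages changes the twist that precedes
each of them; the exponents of `perm` in `a'` and `b'` compensate for this. -/
theorem TwistedRep.over_mul_over_of_triangle {X : Type*} [Quandle X] [Fintype X] [DecidableEq X]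
    {M : Type*} [Ring M] (ρ : TwistedRep X M) (s α β : ℤˣ) {a b a' b' : X}
    (ha : a' = (ρ.perm ^ (-s : ℤ)) a) (hb : b' = (ρ.perm ^ (s * α * β : ℤ)) b) :
    if -s * β = 1 then ρ.overOp β b * ρ.overOp α a = ρ.overOp α a' * ρ.overOp β b'
    else ρ.overOp α a * ρ.overOp β b = ρ.overOp β b' * ρ.overOp α a' := by
  subst ha hb
  rcases Int.units_eq_one_or s with rfl | rfl <;> rcases Int.units_eq_one_or α with rfl | rfl <;>
  rcases Int.units_eq_one_or β with rfl | rfl <;>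
  simp [over_mul_over, units_ne_neg_self, Equiv.eq_symm_apply, eq_comm] <;>
  split_ifs <;> simp_all

namespace GaussDiagram

variable {n : ℕ}

/-! ### The third Reidemeister move and invariance of the state sum -/

section Triangle

variable {X : Type*} [Quandle X] [Fintype X] [DecidableEq X] {R : Type*} [CommRing R]
  {ρ : TwistedRep X (Matrix X X R)}

/-- The change of colours under a third Reidemeister move. -/
def triangleRecolor (ρ : TwistedRep X (Matrix X X R)) (D : GaussDiagram n) (a b c : D.Crossing)
    (s : ℤˣ) (v : D.Crossing → X) (k : D.Crossing) : X :=
  if k = a then (ρ.perm ^ (-s : ℤ)) (v a)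
  else if k = b then (ρ.perm ^ (s * D.sign a * D.sign b : ℤ)) (v b)
  else if k = c then
    if D.sign c = -s then ρ.underPerm (D.sign a) ((ρ.perm ^ (-s : ℤ)) (v a)) (v c)
    else (ρ.underPerm (D.sign a) (v a))⁻¹ (v c)
  else v k

/-- On the finite set of colourings injectivity gives a bijection, so the state sum after the move
can be reindexed by the colourings before it. -/
theorem triangleRecolor_injective (D : GaussDiagram n) {a b c : D.Crossing} (hab : a ≠ b)
    (s : ℤˣ) : Function.Injective (D.triangleRecolor ρ a b c s) := by
  intro v w h
  have ha : v a = w a := by simpa [triangleRecolor] using congrFun h a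
  have hb : v b = w b := by simpa [triangleRecolor, hab.symm] using congrFun h b
  funext k
  by_cases hka : k = a
  · rw [hka, ha]
  by_cases hkb : k = b
  · rw [hkb, hb]
  have hk := congrFun h k
  by_cases hkc : k = c
  · subst hkc
    simp only [triangleRecolor, hka, hkb, if_true, if_false, ha] at hk
    split_ifs at hk <;> simpa using hk
  · simpa [triangleRecolor, hka, hkb, hkc] using hk

/-- `M` holds the matrices of the moved diagram, read on the words of `D`: each of the three
transposed pairs carries the other endpoint's new matrix. The equality is proved one strand at a
time. -/
theorem loopProduct_triangle (D : GaussDiagram n) {a b c : D.Crossing} (hab : a ≠ b)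
    (hac : a ≠ c) (hbc : b ≠ c) {s : ℤˣ}
    (h1 : D.Ordered (-s * D.sign b) (b, .over) (a, .over))
    (h2 : D.Ordered (-s * D.sign c) (c, .over) (a, .under))
    (h3 : D.Ordered (s * D.sign a * D.sign b * D.sign c) (b, .under) (c, .under))
    (v : D.Crossing → X) (M : D.Endpoint → Matrix X X R)
    (hbo : M (b, .over) = D.passage ρ (D.triangleRecolor ρ a b c s v) (a, .over))
    (hao : M (a, .over) = D.passage ρ (D.triangleRecolor ρ a b c s v) (b, .over))
    (hco : M (c, .over) = D.passage ρ (D.triangleRecolor ρ a b c s v) (a, .under))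
    (hau : M (a, .under) = D.passage ρ (D.triangleRecolor ρ a b c s v) (c, .over))
    (hbu : M (b, .under) = D.passage ρ (D.triangleRecolor ρ a b c s v) (c, .under))
    (hcu : M (c, .under) = D.passage ρ (D.triangleRecolor ρ a b c s v) (b, .under))
    (hM : ∀ e : D.Endpoint, e.1 ≠ a → e.1 ≠ b → e.1 ≠ c → M e = D.passage ρ v e) :
    D.loopProduct (D.passage ρ v) = D.loopProduct M := by
  have hneg : ∀ ε δ : ℤˣ, -ε * δ = 1 ↔ δ = -ε := by decide
  have hneg' : ∀ ε δ : ℤˣ, δ ≠ -ε ↔ δ = ε := by decide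
  have hne : ∀ ε : ℤˣ, ε ≠ -ε := by decide
  set w := D.triangleRecolor ρ a b c s v with hw
  have hwa : w a = (ρ.perm ^ (-s : ℤ)) (v a) := by simp [hw, triangleRecolor]
  have hwb : w b = (ρ.perm ^ (s * D.sign a * D.sign b : ℤ)) (v b) := by
    simp [hw, triangleRecolor, hab.symm]
  have hwc : D.sign c = -s → w c = ρ.underPerm (D.sign a) (w a) (v c) := by
    intro h
    simp [hw, triangleRecolor, hac.symm, hbc.symm, h]
  have hwc' : D.sign c = s → v c = ρ.underPerm (D.sign a) (v a) (w c) := by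
    intro h
    simp [hw, triangleRecolor, hac.symm, hbc.symm, h, hne]
  have htop := ρ.over_mul_over_of_triangle s (D.sign a) (D.sign b) hwa hwb
  -- `hP` says that the two over-colours on the top strand are compatible, in the order in which it
  -- meets them. The bottom-strand identity needs this relation; without it the top strand makes
  -- both sides zero.
  by_cases hP : (D.sign b = -s → v a = (ρ.perm ^ (-D.sign b : ℤ)) (v b)) ∧
      (D.sign b = s → v b = (ρ.perm ^ (-D.sign a : ℤ)) (v a))
  · have hbot := ρ.under_mul_under_of_triangle s (D.sign a) (D.sign b) (D.sign c)
      hP.1 hP.2 hwa hwb hwc hwc'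
    -- `L₁` has the top strand moved, `L₂` the top and middle strands, `M` all three.
    let L₁ : D.Endpoint → Matrix X X R := fun e =>
      if e = (b, .over) ∨ e = (a, .over) then M e else D.passage ρ v e
    let L₂ : D.Endpoint → Matrix X X R := fun e =>
      if e = (c, .over) ∨ e = (a, .under) then M e else L₁ e
    calc D.loopProduct (D.passage ρ v) = D.loopProduct L₁ := by
          refine D.loopProduct_congr_ordered h1 _ _ ?_ ?_
          · simpa [L₁, hbo, hao, passage] using htop
          · intro e he he'
            simp [L₁, he, he']
      _ = D.loopProduct L₂ := by
          refine D.loopProduct_congr_ordered h2 _ _ ?_ ?_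
          · split_ifs with h
            · have h := (hneg _ _).1 h
              have := ρ.over_mul_under (D.sign a) (D.sign c) (v c) (v a)
              rw [show ((D.sign c : ℤˣ) : ℤ) = -s by simp [h], ← hwa, ← hwc h] at this
              simpa [L₂, L₁, hco, hau, passage, hac.symm, hbc.symm] using this
            · have h := (hneg' _ _).1 (mt (hneg _ _).2 h)
              have := ρ.over_mul_under (D.sign a) (D.sign c) (w c) (w a)
              rw [h, show (ρ.perm ^ (s : ℤ)) (w a) = v a by simp [hwa], ← hwc' h] at this
              simpa [L₂, L₁, hco, hau, passage, h, hac.symm, hbc.symm] using this.symm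
          · intro e he he'
            simp [L₂, he, he']
      _ = D.loopProduct M := by
          refine D.loopProduct_congr_ordered h3 _ _ ?_ ?_
          · have hb : L₂ (b, .under) = ρ.underOp (D.sign b) (v b) := by
              simp [L₂, L₁, hab.symm, passage]
            have hc : L₂ (c, .under) = ρ.underOp (D.sign c) (v c) := by
              simp [L₂, L₁, hac.symm, passage]
            rw [hb, hc, hbu, hcu]
            split_ifs at hbot ⊢
            · simpa only [passage, Units.val_mul] using congrArg Units.val hbot
            · simpa only [passage, Units.val_mul] using congrArg Units.val hbot
          · rintro ⟨k, t⟩ he he'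
            by_cases hk : k ≠ a ∧ k ≠ b ∧ k ≠ c
            · rw [hM _ hk.1 hk.2.1 hk.2.2]
              simp [L₂, L₁, hk]
            · cases t <;> simp only [L₂, L₁] <;> split_ifs <;> grind
  · have hzero : if -s * D.sign b = 1
        then ρ.overOp (D.sign b) (v b) * ρ.overOp (D.sign a) (v a) = 0
        else ρ.overOp (D.sign a) (v a) * ρ.overOp (D.sign b) (v b) = 0 := by
      rw [TwistedRep.over_mul_over, TwistedRep.over_mul_over]
      split_ifs with h h' h'
      · have h := (hneg _ _).1 h
        exact absurd ⟨fun _ => h', fun h2 => absurd (h2.symm.trans h) (hne s)⟩ hP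
      · rfl
      · have h := (hneg' _ _).1 (mt (hneg _ _).2 h)
        exact absurd ⟨fun h2 => absurd (h.symm.trans h2) (hne s), fun _ => h'⟩ hP
      · rfl
    rw [D.loopProduct_eq_zero_of_ordered h1 _ (by simpa [passage] using hzero),
      D.loopProduct_eq_zero_of_ordered h1 M]
    rw [hbo, hao]
    simp only [passage]
    split_ifs at htop hzero ⊢
    · rw [← htop, hzero]
    · rw [← htop, hzero]

theorem Omega3.stateSum_eq {D D' : GaussDiagram n} (h : D.Omega3 D') :
    D.stateSum ρ = D'.stateSum ρ := by
  obtain ⟨a, b, c, s, hab, hac, hbc, h1, h2, h3, g, hg, hw⟩ := h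
  have h' : D'.stateSum ρ = ∑ v, D'.loopProduct
      (D'.passage ρ (D.triangleRecolor ρ a b c s v ∘ g.symm)) := by
    unfold stateSum
    rw [← Equiv.sum_comp (Equiv.arrowCongr g (Equiv.refl X)),
      ← (Finite.injective_iff_bijective.1
        (D.triangleRecolor_injective (ρ := ρ) (c := c) hab s)).sum_comp]
    rfl
  rw [h', stateSum]
  refine Finset.sum_congr rfl fun v _ => ?_
  rw [loopProduct_eq_of_word_eq_map (D := D) (D' := D') _ (Equiv.refl _)
    (fun i => by rw [Equiv.refl_apply, hw i])]
  have key : ∀ w e, D'.passage ρ (w ∘ g.symm) (Prod.map g id e) = D.passage ρ w e := by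
    rintro w ⟨k, t⟩
    cases t <;> simp [passage, hg]
  refine D.loopProduct_triangle hab hac hbc h1 h2 h3 v _ ?_ ?_ ?_ ?_ ?_ ?_ ?_
  on_goal 7 =>
    rintro ⟨k, t⟩ hka hkb hkc
    simp only [Function.comp_apply, key]
    have : (Equiv.swap ((b, .over) : D.Endpoint) (a, .over) *
            Equiv.swap ((c, .over) : D.Endpoint) (a, .under) *
            Equiv.swap ((b, .under) : D.Endpoint) (c, .under)) (k, t) = (k, t) := by
      simp_all [Equiv.swap_apply_def]
    rw [this]
    simp only at hka hkb hkc
    cases t <;> simp [passage, triangleRecolor, hka, hkb, hkc]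
  all_goals
    simp only [Function.comp_apply, key]
    congr 1
    simp [Equiv.swap_apply_def, hab, hac, hbc, hab.symm, hac.symm, hbc.symm]

theorem Move.stateSum_eq {D D' : GaussDiagram n} (h : D.Move D') :
    D.stateSum ρ = D'.stateSum ρ := by
  rcases h with h | h | h | h
  exacts [h.stateSum_eq, h.stateSum_eq, h.stateSum_eq, h.stateSum_eq]

theorem VirtualEquiv.stateSum_eq {D D' : GaussDiagram n} (h : D.VirtualEquiv D') :
    D.stateSum ρ = D'.stateSum ρ := by
  induction h with
  | rel _ _ h => exact h.stateSum_eq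
  | refl => rfl
  | symm _ _ _ ih => exact ih.symm
  | trans _ _ _ _ _ ih ih' => exact ih.trans ih'

end Triangle

end GaussDiagram

/-! ### Changing the twist -/

namespace TwistedRep

variable {X : Type*} [Quandle X] [Fintype X] [DecidableEq X] {M : Type*} [Ring M]

/-- The same representation with trivial twist. -/
def untwist (ρ : TwistedRep X M) : TwistedRep X M where
  __ := ρ
  twist := 1
  perm := 1
  proj_mul_twist := by simp
  act_mul_twist := by simp

/-- The same representation, twisted by the action of a quandle element. -/
def twistBy (ρ : TwistedRep X M) (w : X) : TwistedRep X M where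
  __ := ρ
  twist := ρ.act w
  perm := Rack.act' w
  proj_mul_twist x := ρ.proj_mul_act x w
  act_mul_twist x := ρ.act_mul_act x w

/-- Orthogonal idempotents kill every non-constant sequence of colours. Writing the result as a sum
over `w` also covers the empty list, where it is `∑ w, proj w = 1`. -/
theorem prod_map_proj (ρ : TwistedRep X M) {α : Type*} (l : List α) (u : α → X) :
    (l.map fun e => ρ.proj (u e)).prod = ∑ w, if ∀ e ∈ l, u e = w then ρ.proj w else 0 := by
  induction l with
  | nil => simp [ρ.sum_proj]
  | cons a l ih =>
    rw [List.map_cons, List.prod_cons, ih, Finset.mul_sum]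
    refine Finset.sum_congr rfl fun w _ => ?_
    simp only [List.forall_mem_cons, mul_ite, mul_zero, ρ.proj_mul_proj]
    by_cases h : u a = w <;> simp [h]

end TwistedRep

namespace GaussDiagram

variable {n : ℕ}

/-! ### Gauge transformations and removal of the twist -/

section Gauge

variable {X : Type*} [Fintype X] [DecidableEq X] {R : Type*} [CommRing R]

theorem pred_eq_prev (D : GaussDiagram n) {i : Fin n} {e : D.Endpoint} (h : e ∈ D.word i) :
    D.pred e = (D.word i).prev e h := by
  obtain rfl := (D.mem_word _ _).1 h
  rfl

theorem prod_map_gauge_of_isChain {M : Type*} [Monoid M] {α : Type*} (P : α → α) (G : α → Mˣ)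
    (L : α → M) (l : List α) (a : α) (h : List.IsChain (fun x y => P y = x) (a :: l)) :
    ((a :: l).map fun e => ↑(G (P e))⁻¹ * L e * G e).prod
      = ↑(G (P a))⁻¹ * ((a :: l).map L).prod * G ((a :: l).getLast (List.cons_ne_nil _ _)) := by
  induction l generalizing a with
  | nil => simp
  | cons b l ih =>
    rw [List.isChain_cons_cons] at h
    rw [List.map_cons, List.prod_cons, ih b h.2, h.1, List.map_cons (f := L) (a := a),
      List.prod_cons, List.getLast_cons (List.cons_ne_nil _ _)]
    simp only [mul_assoc, Units.mul_inv_cancel_left]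

theorem isChain_prev {α : Type*} [DecidableEq α] {l : List α} (hl : l.Nodup) (P : α → α)
    (hP : ∀ e (h : e ∈ l), P e = l.prev e h) : List.IsChain (fun x y => P y = x) l := by
  rw [List.isChain_iff_getElem]
  intro i hi
  rw [hP _ (List.getElem_mem hi), List.prev_getElem _ hl]
  congr 1
  rw [show i + 1 + (l.length - 1) = i + l.length by omega, Nat.add_mod_right,
    Nat.mod_eq_of_lt (by omega)]

/-- Units placed on the short arcs telescope along each word; the two left at its ends cancel under
the trace. -/
theorem loopProduct_gauge (D : GaussDiagram n) (G : D.Endpoint → (Matrix X X R)ˣ)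
    (L : D.Endpoint → Matrix X X R) :
    D.loopProduct (fun e => (↑(G (D.pred e))⁻¹ : Matrix X X R) * L e * (G e : Matrix X X R))
      = D.loopProduct L := by
  unfold loopProduct
  refine Finset.prod_congr rfl fun i _ => ?_
  have hc := isChain_prev (D.nodup i) D.pred fun e h => D.pred_eq_prev h
  have hP : ∀ hl : D.word i ≠ [], D.pred ((D.word i).head hl) = (D.word i).getLast hl := by
    intro hl
    rw [D.pred_eq_prev (List.head_mem hl), List.prev_head_eq_getLast]
  generalize D.word i = l at *
  cases l with
  | nil => rfl
  | cons a l =>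
    rw [prod_map_gauge_of_isChain D.pred G L l a hc]
    have := hP (List.cons_ne_nil _ _)
    rw [List.head_cons] at this
    rw [← this, Matrix.trace_mul_comm, Units.mul_inv_cancel_left]

variable [Quandle X] {ρ : TwistedRep X (Matrix X X R)}

theorem stateSum_eq_untwist {D : GaussDiagram n} (h : D.AlexanderNumerable) :
    D.stateSum ρ = D.stateSum ρ.untwist := by
  obtain ⟨f, hf⟩ := h
  unfold stateSum
  -- Conjugation by `twist ^ f` moves the colour of an over-arc by `perm ^ f`. At the under-strand
  -- the factor `twist ^ f (outgoing)` moves `act` in the same way, because the numbering agrees on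
  -- the incoming over-arc and the outgoing under-arc. The jumps of `f` supply exactly the twists of
  -- the passages.
  refine (Fintype.sum_equiv
    (Equiv.piCongrRight fun c => ρ.perm ^ f (D.incoming (c, .over))) _ _ fun v => ?_).symm
  rw [← D.loopProduct_gauge (fun e => ρ.twist ^ f (D.outgoing e))]
  congr 1
  funext ⟨c, t⟩
  obtain ⟨h1, h2, h3⟩ := hf c
  change ((ρ.twist ^ f (D.incoming (c, t)))⁻¹.val : Matrix X X R) * _ * _ = _
  cases t
  · have hk : f (D.outgoing (c, .over)) = f (D.incoming (c, .over)) + -D.sign c := by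
      rw [h1, h3, h2]
      ring
    simp only [passage, Equiv.piCongrRight_apply, Pi.map_apply, TwistedRep.overOp]
    rw [hk, zpow_add, Units.val_mul, ← mul_assoc]
    congr 1
    rw [mul_assoc, Units.inv_mul_eq_iff_eq_mul, ← TwistedRep.proj_mul_twist_zpow]
    simp [TwistedRep.untwist]
  · simp only [passage, Equiv.piCongrRight_apply, Pi.map_apply, TwistedRep.underOp,
      ← Units.val_mul]
    congr 1
    rw [h1, mul_assoc, mul_assoc]
    have : ρ.untwist.act = ρ.act := rfl
    rw [this, ρ.act_zpow_mul_twist_zpow]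
    simp only [← mul_assoc]
    congr 1
    rw [h3, zpow_add]
    simp [TwistedRep.untwist]

end Gauge

/-! ### The state sum of `Zh(D)` -/

section Zh

variable {X : Type*} [Fintype X] [DecidableEq X] {R : Type*} [CommRing R]

theorem zh_word_castSucc (D : GaussDiagram n) (ω : D.OmegaChoice) (i : Fin n) :
    (D.zh ω).word i.castSucc = (D.word i).flatMap ω.block := by
  simp [zh]

theorem zh_word_last (D : GaussDiagram n) (ω : D.OmegaChoice) :
    (D.zh ω).word (Fin.last n) = ω.tour.map fun e => (Sum.inr e, .over) := by
  simp [zh]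

theorem loopProduct_zh (D : GaussDiagram n) (ω : D.OmegaChoice)
    (L : (D.Crossing ⊕ D.Endpoint) × Strand → Matrix X X R) :
    loopProduct (D.zh ω) L = D.loopProduct (fun e => ((ω.block e).map L).prod) *
      (ω.tour.map fun e => L (Sum.inr e, .over)).prod.trace := by
  unfold loopProduct
  rw [Fin.prod_univ_castSucc]
  congr 1
  · refine Finset.prod_congr rfl fun i _ => ?_
    rw [zh_word_castSucc]
    change Matrix.trace (List.map L ((D.word i).flatMap ω.block)).prod = _
    rw [List.map_flatMap, List.flatMap_def, List.prod_flatten, List.map_map]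
    rfl
  · rw [zh_word_last]
    change Matrix.trace (List.map L (ω.tour.map _)).prod = _
    rw [List.map_map]
    rfl

variable [Quandle X] {ρ : TwistedRep X (Matrix X X R)}

/-- The matrix of a passage of `Zh(D)`, in terms of the colours of the over-arcs. -/
def zhPassage (ρ : TwistedRep X (Matrix X X R)) (D : GaussDiagram n) (v : D.Crossing → X)
    (u : D.Endpoint → X) : (D.Crossing ⊕ D.Endpoint) × Strand → Matrix X X R
  | (Sum.inl c, .over) => ρ.proj (v c)
  | (Sum.inl c, .under) => ↑(ρ.act (v c) ^ (D.sign c : ℤ))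
  | (Sum.inr e, .over) => ρ.proj (u e)
  | (Sum.inr e, .under) => ↑(ρ.act (u e) ^ (D.omegaSign e : ℤ))

theorem stateSum_zh_eq_sum (D : GaussDiagram n) (ω : D.OmegaChoice) :
    (D.zh ω).stateSum ρ.untwist = ∑ v : D.Crossing → X, ∑ u : D.Endpoint → X,
      loopProduct (D.zh ω) (D.zhPassage ρ v u) := by
  unfold stateSum
  rw [← Fintype.sum_prod_type']
  refine Fintype.sum_equiv (Equiv.sumArrowEquivProdArrow D.Crossing D.Endpoint X) _ _ fun v => ?_
  congr 1
  funext ⟨c, t⟩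
  rcases c with c | c <;> cases t <;>
    simp [passage, zhPassage, TwistedRep.untwist, TwistedRep.overOp, TwistedRep.underOp,
      Equiv.sumArrowEquivProdArrow, zh]

/-- With `ω` coloured constantly by `w`, the signs `omegaSign` make each block equal to a passage
twisted by `act w`. When `ω` lies on the other side, the factor `act w` must first be commuted to
the standard place, which recolours that crossing; hence the reindexing by `Rack.act' w ^ sign`. -/
theorem sum_loopProduct_block (D : GaussDiagram n) (ω : D.OmegaChoice) (w : X) :
    ∑ v : D.Crossing → X, D.loopProduct (fun e => ((ω.block e).map
      (D.zhPassage ρ v fun _ => w)).prod) = D.stateSum (ρ.twistBy w) := by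
  unfold stateSum
  refine Fintype.sum_equiv (Equiv.piCongrRight fun c => if ω.side c then 1 else
    Rack.act' w ^ (D.sign c : ℤ)) _ _ fun v => ?_
  congr 1
  funext ⟨c, t⟩
  have hp (x : X) := ρ.proj_mul_act_zpow (-D.sign c) x w
  have ha (x : X) := (ρ.twistBy w).act_zpow_mul_twist_zpow (D.sign c) (D.sign c) x
  cases t <;> cases h : ω.side c <;>
  simp only [OmegaChoice.block, OmegaChoice.before, h, passage, zhPassage, omegaSign,
    TwistedRep.overOp, TwistedRep.underOp, Equiv.piCongrRight_apply, Pi.map_apply,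
    TwistedRep.twistBy, List.map_cons, List.map_nil, List.prod_cons, List.prod_nil, mul_one,
    Bool.not_true, Bool.not_false, if_true, Bool.false_eq_true, if_false, Units.val_neg,
    Equiv.Perm.one_apply, Units.val_mul] at ha ⊢
  · rw [hp, ← Equiv.Perm.mul_apply, ← zpow_add]
    simp
  · rw [← Units.val_mul, ← Units.val_mul, ha]

theorem stateSum_zh (htr : ∀ x, (ρ.proj x).trace = 1) (D : GaussDiagram n) (ω : D.OmegaChoice) :
    (D.zh ω).stateSum ρ.untwist = ∑ w, D.stateSum (ρ.twistBy w) := by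
  simp only [← D.sum_loopProduct_block ω]
  rw [Finset.sum_comm, stateSum_zh_eq_sum]
  refine Finset.sum_congr rfl fun v _ => ?_
  -- As `ω` visits every endpoint and has no under-passages, its trace selects the constant
  -- colourings, each with weight one.
  have h : ∀ u : D.Endpoint → X, (ω.tour.map fun e => D.zhPassage ρ v u
        (Sum.inr e, .over)).prod.trace = ∑ w, if u = fun _ => w then 1 else 0 := by
    intro u
    simp only [zhPassage, ρ.prod_map_proj, ω.mem_tour, true_imp_iff, Matrix.trace_sum, funext_iff]
    refine Finset.sum_congr rfl fun w _ => ?_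
    split_ifs <;> simp [htr]
  simp only [loopProduct_zh, h, Finset.mul_sum]
  rw [Finset.sum_comm]
  refine Finset.sum_congr rfl fun w _ => ?_
  simp

end Zh

end GaussDiagram

/-! ### The representation given by a 2-cocycle -/

section Monomial

variable {X : Type*} [Fintype X] [DecidableEq X] {A : Type*} [CommGroup A]

/-- The monomial matrix over `ℤ[A]` of a permutation and a family of weights. -/
noncomputable def monomialMatrix (σ : Equiv.Perm X) (k : X → A) :
    Matrix X X (MonoidAlgebra ℤ A) :=
  Matrix.of fun x y => if σ x = y then MonoidAlgebra.of ℤ A (k x) else 0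

theorem monomialMatrix_mul_apply (σ : Equiv.Perm X) (k : X → A)
    (N : Matrix X X (MonoidAlgebra ℤ A)) (x y : X) :
    (monomialMatrix σ k * N) x y = MonoidAlgebra.of ℤ A (k x) * N (σ x) y := by
  simp [monomialMatrix, Matrix.mul_apply]

theorem monomialMatrix_mul (σ τ : Equiv.Perm X) (k l : X → A) :
    monomialMatrix σ k * monomialMatrix τ l
      = monomialMatrix (τ * σ) (fun x => k x * l (σ x)) := by
  refine Matrix.ext fun x y => ?_
  rw [monomialMatrix_mul_apply]
  simp only [monomialMatrix, Matrix.of_apply, Equiv.Perm.mul_apply]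
  by_cases h : τ (σ x) = y
  · simp only [h, if_true, map_mul]
  · simp only [h, if_false, mul_zero]

omit [Fintype X] in
theorem monomialMatrix_one : monomialMatrix (1 : Equiv.Perm X) (fun _ => (1 : A)) = 1 := by
  refine Matrix.ext fun x y => ?_
  simp only [monomialMatrix, Matrix.of_apply, map_one, Matrix.one_apply, Equiv.Perm.one_apply]

/-- A monomial matrix as a unit. -/
noncomputable def monomialUnit (σ : Equiv.Perm X) (k : X → A) :
    (Matrix X X (MonoidAlgebra ℤ A))ˣ where
  val := monomialMatrix σ k
  inv := monomialMatrix σ⁻¹ (fun x => (k (σ⁻¹ x))⁻¹)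
  val_inv := by simp [monomialMatrix_mul, monomialMatrix_one]
  inv_val := by simp [monomialMatrix_mul, monomialMatrix_one]

end Monomial

section CocycleRep

variable {X : Type*} [Quandle X] [Fintype X] [DecidableEq X] {A : Type*} [CommGroup A]

/-- The representation of a finite quandle given by a 2-cocycle, with trivial twist. -/
noncomputable def IsQuandleTwoCocycle.rep {φ : X → X → A} (h : IsQuandleTwoCocycle φ) :
    TwistedRep X (Matrix X X (MonoidAlgebra ℤ A)) where
  proj x := Matrix.diagonal (Pi.single x 1)
  act y := monomialUnit (Rack.act' y) (fun x => φ x y)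
  twist := 1
  perm := 1
  proj_mul_proj x y := by
    rw [Matrix.diagonal_mul_diagonal]
    split_ifs with hxy
    · subst hxy
      congr 1
      funext i
      by_cases hi : i = x <;> simp [hi]
    · rw [← Matrix.diagonal_zero]
      congr 1
      funext i
      by_cases hi : i = x <;> simp [Pi.single_apply, hi, hxy]
  sum_proj := by
    rw [← Matrix.diagonal_one]
    refine Matrix.ext fun i j => ?_
    rw [Matrix.sum_apply]
    by_cases hij : i = j <;> simp [hij, Pi.single_apply]
  proj_mul_act x z := by
    refine Matrix.ext fun i j => ?_
    simp only [monomialUnit, Matrix.diagonal_mul, Matrix.mul_diagonal, monomialMatrix,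
      Matrix.of_apply, Pi.single_apply]
    change (if i = x then 1 else 0) * (if z ◃ i = j then _ else _)
      = (if z ◃ i = j then _ else _) * (if j = z ◃ x then 1 else 0)
    by_cases hij : z ◃ i = j
    · subst hij
      simp only [Rack.left_cancel]
      split_ifs <;> simp
    · simp [hij]
  act_mul_act x z := by
    refine Units.ext ?_
    simp only [monomialUnit, Units.val_mul, monomialMatrix_mul]
    congr 1
    · ext a
      exact Shelf.self_distrib
    · funext a
      -- Both products of monomial matrices have the same permutation by self-distributivity;
      -- equality of their weights is the cocycle identity.
      have := h.cocycle a x z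
      rw [mul_comm (φ (x ◃ a) z)] at this
      exact this.symm
  proj_mul_twist := by simp
  act_mul_twist := by simp
  proj_mul_act_self x := by
    refine Matrix.ext fun i j => ?_
    simp only [monomialUnit, Matrix.diagonal_mul, Matrix.diagonal_apply, monomialMatrix,
      Matrix.of_apply, Pi.single_apply]
    by_cases hi : i = x
    · subst hi
      have : Rack.act' i i = i := Quandle.fix
      rw [this, h.diag, map_one]
      simp
    · simp [hi]

theorem IsQuandleTwoCocycle.trace_proj {φ : X → X → A} (h : IsQuandleTwoCocycle φ) (x : X) :
    (h.rep.proj x).trace = 1 := by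
  simp [rep, Matrix.trace_diagonal]

/-- At a negative crossing the source is the outgoing under-arc, so row and column exchange roles
and the matrix entry is precisely the coloring condition times the Boltzmann weight. -/
theorem IsQuandleTwoCocycle.act_zpow_apply {φ : X → X → A} (h : IsQuandleTwoCocycle φ) (ε : ℤˣ)
    (x y a : X) : (↑(h.rep.act y ^ (ε : ℤ)) : Matrix X X (MonoidAlgebra ℤ A)) x a =
      if y ◃ (if ε = 1 then x else a) = (if ε = 1 then a else x) then
        MonoidAlgebra.of ℤ A (φ (if ε = 1 then x else a) y ^ (ε : ℤ)) else 0 := by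
  rcases Int.units_eq_one_or ε with rfl | rfl
  · simp only [Units.val_one, zpow_one, if_true]
    rfl
  · have hne : (-1 : ℤˣ) ≠ 1 := by decide
    have hi : ((Rack.act' y)⁻¹ x = a) ↔ y ◃ a = x := by
      rw [Equiv.Perm.inv_eq_iff_eq, eq_comm]
      rfl
    simp only [hne, if_false, Units.val_neg, Units.val_one, zpow_neg, zpow_one]
    change (if (Rack.act' y)⁻¹ x = a then MonoidAlgebra.of ℤ A (φ ((Rack.act' y)⁻¹ x) y)⁻¹
      else 0) = _
    by_cases hx : (Rack.act' y)⁻¹ x = a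
    · rw [if_pos hx, if_pos (hi.1 hx), hx]
    · rw [if_neg hx, if_neg (mt hi.2 hx)]

end CocycleRep

/-! ### Traces as sums over closed paths -/

section Paths

variable {X : Type*} [Fintype X] [DecidableEq X] {R : Type*} [CommRing R]

theorem prod_ofFn_apply {m : ℕ} (M : Fin m → Matrix X X R) (x y : X) :
    (List.ofFn M).prod x y = ∑ f : Fin m → X,
      (∏ j, M j ((Fin.cons x f : Fin (m + 1) → X) j.castSucc) (f j)) *
        if (Fin.cons x f : Fin (m + 1) → X) (Fin.last m) = y then 1 else 0 := by
  induction m generalizing x with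
  | zero => simp [Matrix.one_apply]
  | succ m ih =>
    rw [List.ofFn_succ, List.prod_cons, Matrix.mul_apply,
      ← (Fin.consEquiv fun _ : Fin (m + 1) => X).sum_comp, Fintype.sum_prod_type]
    refine Finset.sum_congr rfl fun z _ => ?_
    rw [ih, Finset.mul_sum]
    refine Finset.sum_congr rfl fun f _ => ?_
    rw [Fin.prod_univ_succ, ← mul_assoc]
    simp only [Fin.consEquiv_apply, Fin.castSucc_zero, Fin.cons_zero, ← Fin.succ_castSucc,
      Fin.cons_succ, ← Fin.succ_last]

/-- `f j` is the index after letter `j`; the index before it is that of the cyclic predecessor, and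
`j + Fin.last m` is `j - 1` modulo `m + 1`. -/
theorem trace_prod_ofFn {m : ℕ} (M : Fin (m + 1) → Matrix X X R) :
    (List.ofFn M).prod.trace
      = ∑ f : Fin (m + 1) → X, ∏ j, M j (f (j + Fin.last m)) (f j) := by
  simp only [Matrix.trace, Matrix.diag, prod_ofFn_apply]
  rw [Finset.sum_comm]
  refine Finset.sum_congr rfl fun f _ => ?_
  simp only [← Fin.succ_last, Fin.cons_succ, mul_ite, mul_one, mul_zero]
  rw [Finset.sum_ite_eq, if_pos (Finset.mem_univ _)]
  refine Finset.prod_congr rfl fun j _ => ?_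
  congr 1
  cases j using Fin.cases with
  | zero => simp
  | succ j =>
    rw [← Fin.succ_castSucc, Fin.cons_succ]
    congr 1
    ext
    simp only [Fin.val_castSucc, Fin.val_add, Fin.val_succ, Fin.val_last]
    rw [show (j : ℕ) + 1 + m = j + (m + 1) by ring, Nat.add_mod_right, Nat.mod_eq_of_lt (by omega)]

end Paths

/-! ### Homomorphisms from a presented quandle -/

/-- The value of a quandle word in a quandle. -/
def QuandleWord.eval {S : Type u} {X : Type v} [Quandle X] (F : S → X) : QuandleWord S → X
  | gen s => F s
  | act x y => x.eval F ◃ y.eval F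
  | invAct x y => x.eval F ◃⁻¹ y.eval F

theorem QuandleWord.Rel.eval_eq {S : Type u} {X : Type v} [Quandle X] {R : S → S → S → Prop}
    {F : S → X} (hF : ∀ s t w, R s t w → F s ◃ F t = F w) {x y : QuandleWord S}
    (h : QuandleWord.Rel R x y) : x.eval F = y.eval F := by
  induction h with
  | refl => rfl
  | symm _ ih => exact ih.symm
  | trans _ _ ih ih' => exact ih.trans ih'
  | congrAct _ _ ih ih' => simp only [QuandleWord.eval, ih, ih']
  | congrInvAct _ _ ih ih' => simp only [QuandleWord.eval, ih, ih']
  | selfDistrib => exact Shelf.self_distrib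
  | invActAct => exact Rack.left_inv _ _
  | actInvAct => exact Rack.right_inv _ _
  | fix => exact Quandle.fix
  | rel h => exact hF _ _ _ h

/-- The homomorphism given by its values on the generators. -/
def PresentedQuandle.lift {S : Type u} {X : Type v} [Quandle X] {R : S → S → S → Prop}
    (F : S → X) (hF : ∀ s t w, R s t w → F s ◃ F t = F w) : PresentedQuandle R →◃ X where
  toFun := Quotient.lift (QuandleWord.eval F) fun _ _ h => QuandleWord.Rel.eval_eq hF h
  map_act' := by
    rintro ⟨x⟩ ⟨y⟩
    rfl

namespace GaussDiagram

variable {n : ℕ}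

/-! ### Loop products as sums over labellings of the short arcs -/

section Expansion

variable {X : Type*} [Fintype X] [DecidableEq X] {R : Type*} [CommRing R]

/-- The circle that contains a short arc. -/
def arcComp (D : GaussDiagram n) : D.ShortArc → Fin n := Sum.elim D.comp Subtype.val

theorem comp_pred (D : GaussDiagram n) (e : D.Endpoint) : D.comp (D.pred e) = D.comp e :=
  (D.mem_word _ _).1 (List.prev_mem _ _ _)

theorem trace_word_eq_sum (D : GaussDiagram n) (L : D.Endpoint → Matrix X X R) (i : Fin n) :
    ((D.word i).map L).prod.trace = ∑ F : {s // D.arcComp s = i} → X,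
      ∏ e : {e // D.comp e = i}, L e (F ⟨D.incoming e, (D.comp_pred e).trans e.2⟩)
        (F ⟨D.outgoing e, e.2⟩) := by
  rcases hl : D.word i with - | ⟨a, l⟩
  -- On a circle without crossings the trace of the identity is `|X|`, matching the free colour of
  -- its single short arc.
  · have : IsEmpty {e // D.comp e = i} := ⟨fun e => by
      have := (D.mem_word _ _).2 e.2
      simp [hl] at this⟩
    have : Unique {s // D.arcComp s = i} :=
      { default := ⟨Sum.inr ⟨i, hl⟩, rfl⟩
        uniq := by
          rintro ⟨e | ⟨j, hj⟩, rfl⟩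
          · exact (this.false ⟨e, rfl⟩).elim
          · rfl }
    rw [← (Equiv.funUnique {s // D.arcComp s = i} X).symm.sum_comp]
    simp [Matrix.trace_one]
  · have hlen : (D.word i).length = l.length + 1 := by rw [hl, List.length_cons]
    let E : Fin (l.length + 1) ≃ {e // D.comp e = i} :=
      (finCongr hlen.symm).trans (((D.nodup i).getEquiv _).trans
        (Equiv.subtypeEquivRight fun e => D.mem_word e i))
    have hE : ∀ j, (E j : D.Endpoint) = (D.word i)[(j : ℕ)]'(by omega) := fun j => rfl
    let E' : {e // D.comp e = i} ≃ {s // D.arcComp s = i} :=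
      { toFun := fun e => ⟨Sum.inl e, e.2⟩
        invFun := fun s => match s with
          | ⟨Sum.inl e, h⟩ => ⟨e, h⟩
          | ⟨Sum.inr j, h⟩ => absurd ((congrArg D.word h.symm).trans j.2) (by simp [hl])
        left_inv := fun e => rfl
        right_inv := by
          rintro ⟨e | j, h⟩
          · rfl
          · exact absurd ((congrArg D.word h.symm).trans j.2) (by simp [hl]) }
    have hofFn : ((a :: l).map L) = List.ofFn fun j => L (E j) := by
      rw [← hl]
      refine List.ext_getElem (by simp [hlen]) fun k h1 h2 => ?_
      rw [List.getElem_map, List.getElem_ofFn]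
      rfl
    rw [hofFn, trace_prod_ofFn, ← (Equiv.arrowCongr (E.trans E') (Equiv.refl X)).sum_comp]
    refine Finset.sum_congr rfl fun f _ => ?_
    rw [← E.prod_comp]
    refine Finset.prod_congr rfl fun j _ => ?_
    have h1 : (E.trans E').symm ⟨D.outgoing (E j), (E j).2⟩ = j :=
      (Equiv.symm_apply_eq _).2 rfl
    have h2 : (E.trans E').symm ⟨D.incoming (E j), (D.comp_pred (E j)).trans (E j).2⟩
        = j + Fin.last _ := by
      refine (Equiv.symm_apply_eq _).2 (Subtype.ext ?_)
      change Sum.inl (D.pred (E j)) = Sum.inl _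
      congr 1
      have hm : (E j : D.Endpoint) ∈ D.word i := (D.mem_word _ _).2 (E j).2
      rw [D.pred_eq_prev hm]
      have hp : ∀ e (he : e ∈ D.word i), e = (D.word i)[(j : ℕ)]'(by omega) →
          (D.word i).prev e he = E (j + Fin.last _) := by
        rintro _ he rfl
        rw [List.prev_getElem _ (D.nodup i), hE]
        congr 1
        simp [Fin.val_add, hlen]
      exact hp _ hm (hE j)
    change _ = L (E j) (f ((E.trans E').symm _)) (f ((E.trans E').symm _))
    rw [h1, h2]

theorem loopProduct_eq_sum (D : GaussDiagram n) (L : D.Endpoint → Matrix X X R) :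
    D.loopProduct L = ∑ f : D.ShortArc → X,
      ∏ e, L e (f (D.incoming e)) (f (D.outgoing e)) := by
  unfold loopProduct
  simp only [trace_word_eq_sum]
  rw [Finset.prod_univ_sum, Fintype.piFinset_univ]
  let Φ : (∀ i, {s // D.arcComp s = i} → X) ≃ (D.ShortArc → X) :=
    (Equiv.piCurry fun (i : Fin n) (_ : {s // D.arcComp s = i}) => X).symm.trans
      (Equiv.arrowCongr (Equiv.sigmaFiberEquiv D.arcComp) (Equiv.refl X))
  refine Fintype.sum_equiv Φ _ _ fun F => ?_
  rw [← (Equiv.sigmaFiberEquiv D.comp).prod_comp, Fintype.prod_sigma]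
  refine Finset.prod_congr rfl fun i _ => Finset.prod_congr rfl fun e _ => ?_
  obtain ⟨e, rfl⟩ := e
  have h : ∀ s i (h : D.arcComp s = i), Φ F s = F i ⟨s, h⟩ := by
    rintro s _ rfl
    rfl
  exact congrArg₂ (L e) (h (D.incoming e) _ (D.comp_pred e)).symm (h (D.outgoing e) _ rfl).symm

end Expansion

end GaussDiagram

/-! ### The untwisted state sum as the cocycle invariant -/

theorem Strand.prod_univ {M : Type*} [CommMonoid M] (f : Strand → M) :
    ∏ t, f t = f .over * f .under :=
  Finset.prod_pair (by decide)

namespace GaussDiagram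

variable {n : ℕ}

/-- The short under-arc to the right of the over-strand. -/
def sourceShortArc (D : GaussDiagram n) (c : D.Crossing) : D.ShortArc :=
  if D.sign c = 1 then D.incoming (c, .under) else D.outgoing (c, .under)

/-- The short under-arc to the left of the over-strand. -/
def targetShortArc (D : GaussDiagram n) (c : D.Crossing) : D.ShortArc :=
  if D.sign c = 1 then D.outgoing (c, .under) else D.incoming (c, .under)

theorem arcOf_sourceShortArc (D : GaussDiagram n) (c : D.Crossing) :
    D.arcOf (D.sourceShortArc c) = D.sourceArc c := by
  unfold sourceShortArc sourceArc
  split_ifs <;> rfl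

theorem arcOf_targetShortArc (D : GaussDiagram n) (c : D.Crossing) :
    D.arcOf (D.targetShortArc c) = D.targetArc c := by
  unfold targetShortArc targetArc
  split_ifs <;> rfl

/-- The condition on the colours of the short arcs at a crossing. -/
def IsColoredAt {X : Type*} [Quandle X] (D : GaussDiagram n) (f : D.ShortArc → X)
    (c : D.Crossing) : Prop :=
  f (D.incoming (c, .over)) = f (D.outgoing (c, .over)) ∧
    f (D.outgoing (c, .over)) ◃ f (D.sourceShortArc c) = f (D.targetShortArc c)

/-- Colorings are the labellings of the short arcs that are compatible with all crossings. -/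
def coloringEquiv (D : GaussDiagram n) (X : Type u) [Quandle X] :
    D.Coloring X ≃ {f : D.ShortArc → X // ∀ c, D.IsColoredAt f c} where
  toFun χ := ⟨fun s => χ.color (D.arcOf s), fun c => by
    refine ⟨congrArg χ.color (Quot.sound (ArcStep.over c)), ?_⟩
    beta_reduce
    rw [arcOf_sourceShortArc, arcOf_targetShortArc]
    unfold Coloring.color
    rw [← ShelfHom.map_act]
    exact congrArg χ (Quotient.sound (QuandleWord.Rel.rel (CrossingRel.mk c)))⟩
  invFun f := PresentedQuandle.lift
    (Quot.lift f.1 fun _ _ h => by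
      obtain ⟨c⟩ := h
      exact (f.2 c).1)
    (by
      rintro _ _ _ ⟨c⟩
      rw [← arcOf_sourceShortArc, ← arcOf_targetShortArc]
      exact (f.2 c).2)
  left_inv χ := by
    refine PresentedQuandle.hom_ext ?_
    rintro ⟨s⟩
    rfl
  right_inv f := rfl

theorem prod_endpoint (D : GaussDiagram n) {M : Type*} [CommMonoid M] (F : D.Endpoint → M) :
    ∏ e, F e = ∏ c, (F (c, .over) * F (c, .under)) := by
  rw [Fintype.prod_prod_type]
  exact Finset.prod_congr rfl fun c _ => Strand.prod_univ _

theorem cocycleInvariant_eq_stateSum {X : Type u} [Quandle X] [Fintype X] [DecidableEq X]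
    {A : Type v} [CommGroup A] {φ : X → X → A} (hφ : IsQuandleTwoCocycle φ) (D : GaussDiagram n) :
    D.cocycleInvariant φ = D.stateSum hφ.rep.untwist := by
  classical
  unfold stateSum
  simp only [loopProduct_eq_sum]
  rw [Finset.sum_comm]
  have key : ∀ f : D.ShortArc → X,
      ∑ v : D.Crossing → X, ∏ e, D.passage hφ.rep.untwist v e (f (D.incoming e)) (f (D.outgoing e))
      = if ∀ c, D.IsColoredAt f c then MonoidAlgebra.of ℤ A (∏ c,
          φ (f (D.sourceShortArc c)) (f (D.outgoing (c, .over))) ^ (D.sign c : ℤ)) else 0 := by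
    intro f
    simp only [prod_endpoint]
    -- For a fixed labelling the sum over `v` factors over the crossings. The diagonal `proj y`
    -- forces `y` to be the common label of the two short over-arcs, leaving the Boltzmann weight if
    -- the crossing is properly coloured and zero otherwise.
    have h1 : ∀ c, ∑ y : X, (hφ.rep.untwist.overOp (D.sign c) y
          (f (D.incoming (c, .over))) (f (D.outgoing (c, .over))) *
        (hφ.rep.untwist.underOp (D.sign c) y : Matrix X X (MonoidAlgebra ℤ A))
          (f (D.incoming (c, .under))) (f (D.outgoing (c, .under))))
        = if D.IsColoredAt f c then MonoidAlgebra.of ℤ A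
          (φ (f (D.sourceShortArc c)) (f (D.outgoing (c, .over))) ^ (D.sign c : ℤ)) else 0 := by
      intro c
      have h2 : ∀ y, hφ.rep.untwist.overOp (D.sign c) y = Matrix.diagonal (Pi.single y 1) := by
        intro y
        simp [TwistedRep.overOp, TwistedRep.untwist, IsQuandleTwoCocycle.rep]
      have h3 : ∀ y, hφ.rep.untwist.underOp (D.sign c) y = hφ.rep.act y ^ (D.sign c : ℤ) := by
        intro y
        simp [TwistedRep.underOp, TwistedRep.untwist]
      simp only [h2, h3, hφ.act_zpow_apply, Matrix.diagonal_apply, IsColoredAt, sourceShortArc,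
        targetShortArc, apply_ite f]
      by_cases h : f (D.incoming (c, .over)) = f (D.outgoing (c, .over))
      · simp only [h, if_true, true_and, Pi.single_apply, ite_mul, one_mul, zero_mul]
        rw [Finset.sum_ite_eq, if_pos (Finset.mem_univ _)]
      · simp only [h, if_false, false_and, zero_mul, Finset.sum_const_zero]
    refine Eq.trans ?_ ((Finset.prod_congr (s₁ := Finset.univ) rfl fun c _ => h1 c).trans ?_)
    · rw [Finset.prod_univ_sum, Fintype.piFinset_univ]
      rfl
    · rw [Finset.prod_ite_zero, map_prod]
      simp
  simp only [key]
  rw [← Finset.sum_filter, Finset.sum_subtype _ (p := fun f => ∀ c, D.IsColoredAt f c) (by simp)]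
  unfold cocycleInvariant
  refine Fintype.sum_equiv (D.coloringEquiv X) _ _ fun χ => ?_
  congr 1
  refine Finset.prod_congr rfl fun c _ => ?_
  rw [boltzmannWeight, ← arcOf_sourceShortArc]
  rfl

/-! ### Almost classical links, the unknot and coloring counts -/

theorem extendedCocycleInvariant_eq {X : Type u} [Quandle X] [Finite X] {A : Type v}
    [CommGroup A] {φ : X → X → A} (hφ : IsQuandleTwoCocycle φ) {D : GaussDiagram n}
    (ω : D.OmegaChoice) (h : D.AlmostClassical) :
    D.extendedCocycleInvariant ω φ = Nat.card X • D.cocycleInvariant φ := by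
  classical
  have := Fintype.ofFinite X
  obtain ⟨D', hD, hn⟩ := h
  -- Move to the numbered diagram with the twist on, remove the twist there, and move back without
  -- it.
  have hw : ∀ w, D.stateSum (hφ.rep.twistBy w) = D.cocycleInvariant φ := by
    intro w
    rw [hD.stateSum_eq, stateSum_eq_untwist hn, cocycleInvariant_eq_stateSum hφ,
      hD.stateSum_eq]
    rfl
  rw [extendedCocycleInvariant, cocycleInvariant_eq_stateSum hφ, stateSum_zh hφ.trace_proj]
  simp only [hw, Finset.sum_const, Finset.card_univ, Nat.card_eq_fintype_card]

theorem cocycleInvariant_eq_of_virtualEquiv {X : Type u} [Quandle X] [Finite X] {A : Type v}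
    [CommGroup A] {φ : X → X → A} (hφ : IsQuandleTwoCocycle φ) {D D' : GaussDiagram n}
    (h : D.VirtualEquiv D') : D.cocycleInvariant φ = D'.cocycleInvariant φ := by
  classical
  have := Fintype.ofFinite X
  rw [cocycleInvariant_eq_stateSum hφ, cocycleInvariant_eq_stateSum hφ, h.stateSum_eq]

theorem cocycleInvariant_unknot {X : Type u} [Quandle X] [Finite X] {A : Type v}
    [CommGroup A] {φ : X → X → A} (hφ : IsQuandleTwoCocycle φ) :
    unknot.cocycleInvariant φ = Nat.card X • (1 : MonoidAlgebra ℤ A) := by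
  classical
  have := Fintype.ofFinite X
  rw [cocycleInvariant_eq_stateSum hφ, stateSum]
  have h : ∀ v, unknot.loopProduct (unknot.passage hφ.rep.untwist v)
      = Nat.card X • (1 : MonoidAlgebra ℤ A) := by
    intro v
    simp [loopProduct, unknot, Matrix.trace_one]
  have : Unique (unknot.Crossing → X) := inferInstanceAs (Unique (Empty → X))
  rw [Fintype.sum_unique, h]

theorem almostClassical_of_virtualEquiv_unknot {D : GaussDiagram 1}
    (h : D.VirtualEquiv unknot) : D.AlmostClassical :=
  ⟨unknot, h, fun _ => 0, fun c => c.elim⟩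

theorem isQuandleTwoCocycle_one (X : Type u) [Quandle X] (A : Type v) [CommGroup A] :
    IsQuandleTwoCocycle (fun _ _ : X => (1 : A)) :=
  ⟨fun _ _ _ => rfl, fun _ => rfl⟩

theorem cocycleInvariant_one (D : GaussDiagram n) (X : Type u) [Quandle X] [Finite X] :
    D.cocycleInvariant (fun _ _ : X => (1 : Unit))
      = ((Nat.card (D.Coloring X) : ℕ) : MonoidAlgebra ℤ Unit) := by
  simp only [cocycleInvariant, boltzmannWeight, one_zpow, Finset.prod_const_one, map_one,
    Finset.sum_const, Finset.card_univ, nsmul_one, Nat.card_eq_fintype_card]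

theorem card_extendedColoring {X : Type u} [Quandle X] [Finite X] {D : GaussDiagram n}
    (ω : D.OmegaChoice) (h : D.AlmostClassical) :
    Nat.card (D.ExtendedColoring ω X) = Nat.card X * Nat.card (D.Coloring X) := by
  have := extendedCocycleInvariant_eq (isQuandleTwoCocycle_one X Unit) ω h
  rw [extendedCocycleInvariant, cocycleInvariant_one, cocycleInvariant_one, nsmul_eq_mul,
    ← Nat.cast_mul] at this
  -- The augmentation `ℤ[Unit] → ℤ` recovers the coloring counts as integers.
  have h2 := congrArg (MonoidAlgebra.lift ℤ ℤ Unit 1) this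
  rw [map_natCast, map_natCast] at h2
  exact_mod_cast h2

theorem card_coloring_of_virtualEquiv_unknot {X : Type u} [Quandle X] [Finite X]
    {D : GaussDiagram 1} (h : D.VirtualEquiv unknot) :
    Nat.card (D.Coloring X) = Nat.card X := by
  have := cocycleInvariant_eq_of_virtualEquiv (isQuandleTwoCocycle_one X Unit) h
  rw [cocycleInvariant_unknot (isQuandleTwoCocycle_one X Unit), cocycleInvariant_one,
    nsmul_one] at this
  have h2 := congrArg (MonoidAlgebra.lift ℤ ℤ Unit 1) this
  rw [map_natCast, map_natCast] at h2
  exact_mod_cast h2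

end GaussDiagram

theorem mainTheorem10 (X : Type u) [Quandle X] [Finite X] :
    (∀ (n : ℕ) (D : GaussDiagram n) (ω : D.OmegaChoice), D.AlmostClassical →
      Nat.card (D.ExtendedColoring ω X) = Nat.card X * Nat.card (D.Coloring X)) ∧
    (∀ (D : GaussDiagram 1) (ω : D.OmegaChoice), D.VirtualEquiv GaussDiagram.unknot →
      Nat.card (D.ExtendedColoring ω X) = Nat.card X ^ 2) ∧
    (∀ (A : Type v) [CommGroup A] (φ : X → X → A), IsQuandleTwoCocycle φ →
      (∀ (n : ℕ) (D : GaussDiagram n) (ω : D.OmegaChoice), D.AlmostClassical →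
        D.extendedCocycleInvariant ω φ = Nat.card X • D.cocycleInvariant φ) ∧
      (∀ (D : GaussDiagram 1) (ω : D.OmegaChoice), D.VirtualEquiv GaussDiagram.unknot →
        D.extendedCocycleInvariant ω φ = (Nat.card X ^ 2) • (1 : MonoidAlgebra ℤ A))) := by
  refine ⟨fun n D ω h => GaussDiagram.card_extendedColoring ω h, fun D ω h => ?_,
    fun A _ φ hφ => ⟨fun n D ω h => GaussDiagram.extendedCocycleInvariant_eq hφ ω h,
      fun D ω h => ?_⟩⟩
  · rw [GaussDiagram.card_extendedColoring ω
      (GaussDiagram.almostClassical_of_virtualEquiv_unknot h),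
      GaussDiagram.card_coloring_of_virtualEquiv_unknot h, sq]
  · rw [GaussDiagram.extendedCocycleInvariant_eq hφ ω
      (GaussDiagram.almostClassical_of_virtualEquiv_unknot h),
      GaussDiagram.cocycleInvariant_eq_of_virtualEquiv hφ h,
      GaussDiagram.cocycleInvariant_unknot hφ, smul_smul, sq]
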